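/- Let $N\ge 2$ and let $\Omega\subset\mathbb{R}^N$ be a smoothly bounded domain, i.e. a nonempty bounded connected open set whose boundary is the disjoint union of finitely many smooth ($C^\infty$) closed hypersurfaces (so that near each boundary point $p$ the set $\Omega$ is given by $\{\rho<0\}$ for some $C^\infty$ function $\rho$ with $\nabla\rho(p)\neq 0$). Let $C^1(\overline\Omega)$ denote the space of functions that are continuous on $\overline\Omega$ and $C^1$ on $\Omega$, and whose gradient extends continuously to $\overline\Omega$; the extension is again denoted by $\nabla u$. Write $\|\cdot\|$ for the Euclidean norm, $\|f\|_{S}=\sup_{S}\|f\|$ for a vector field $f$ on a set $S$, and $$\lambda_1(\Omega)=\inf\{\|\nabla v\|_{\overline\Omega} : v\in C^1(\overline\Omega)\text{ and }\Delta v=N\text{ on }\Omega\}.$$ Suppose that $u\in C^1(\overline\Omega)$ satisfies $\Delta u=N$ on $\Omega$. If $\|\nabla u\|_{\overline\Omega}=\lambda_1(\Omega)$, then $\|\nabla u\|$ is constant on $\partial\Omega$; more precisely, $\|\nabla u(x)\|=\lambda_1(\Omega)$ for every $x\in\partial\Omega$. -/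

import Mathlib

open Set Filter Topology
open scoped ContDiff Gradient InnerProductSpace

/-- `Ω` is a smoothly bounded domain of `ℝᴺ`: a nonempty connected bounded open set which, near
each of its boundary points `p`, is the sublevel set `{ρ < 0}` of a `C^∞` function `ρ` with
nonvanishing derivative at `p`.  (By compactness, the boundary is then a disjoint union of
finitely many connected smooth closed hypersurfaces.) -/
structure IsSmoothBoundedDomain {N : ℕ} (Ω : Set (EuclideanSpace ℝ (Fin N))) : Prop where
  isOpen : IsOpen Ω
  isConnected : IsConnected Ω
  isBounded : Bornology.IsBounded Ω
  smooth_boundary : ∀ p ∈ frontier Ω, ∃ U : Set (EuclideanSpace ℝ (Fin N)),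
    ∃ ρ : EuclideanSpace ℝ (Fin N) → ℝ, IsOpen U ∧ p ∈ U ∧ ContDiffOn ℝ ∞ ρ U ∧
      fderiv ℝ ρ p ≠ 0 ∧ Ω ∩ U = {x ∈ U | ρ x < 0}

/-- `u ∈ C¹(Ω̄)` for an open set `Ω`: `u` is continuous on `Ω̄`, is `C¹` on `Ω`, and its gradient
has a limit from within `Ω` at every boundary point (that is, `∇u` extends continuously
from `Ω` to `Ω̄`). -/
structure IsC1Closure {N : ℕ} (Ω : Set (EuclideanSpace ℝ (Fin N)))
    (u : EuclideanSpace ℝ (Fin N) → ℝ) : Prop where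
  continuousOn : ContinuousOn u (closure Ω)
  contDiffOn : ContDiffOn ℝ 1 u Ω
  tendsto_gradient : ∀ x ∈ frontier Ω, ∃ y : EuclideanSpace ℝ (Fin N),
    Tendsto (fun z => ∇ u z) (𝓝[Ω] x) (𝓝 y)

/-- The gradient of `u ∈ C¹(Ω̄)` as a vector field on `Ω̄`: the continuous extension to `Ω̄` of
`∇u` on `Ω`. -/
noncomputable def gradClosure {N : ℕ} (Ω : Set (EuclideanSpace ℝ (Fin N)))
    (u : EuclideanSpace ℝ (Fin N) → ℝ) :
    EuclideanSpace ℝ (Fin N) → EuclideanSpace ℝ (Fin N) :=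
  extendFrom Ω (fun z => ∇ u z)

/-- `‖f‖_S = sup_S ‖f‖` (Euclidean norm) for a vector field `f`. -/
noncomputable def supNormOn {N : ℕ} (S : Set (EuclideanSpace ℝ (Fin N)))
    (f : EuclideanSpace ℝ (Fin N) → EuclideanSpace ℝ (Fin N)) : ℝ :=
  sSup ((fun x => ‖f x‖) '' S)

/-- `Δu = c` on the open set `Ω`, in the classical sense. -/
def HasLaplacianOn {N : ℕ} (Ω : Set (EuclideanSpace ℝ (Fin N)))
    (u : EuclideanSpace ℝ (Fin N) → ℝ) (c : ℝ) : Prop :=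
  ContDiffOn ℝ 2 u Ω ∧ ∀ x ∈ Ω, Laplacian.laplacian u x = c

/-- `λ₁(Ω) = inf {‖∇u‖_{Ω̄} : u ∈ C¹(Ω̄) and Δu = N on Ω}`. -/
noncomputable def lambdaOne {N : ℕ} (Ω : Set (EuclideanSpace ℝ (Fin N))) : ℝ :=
  sInf {t : ℝ | ∃ u : EuclideanSpace ℝ (Fin N) → ℝ,
    IsC1Closure Ω u ∧ HasLaplacianOn Ω u N ∧ t = supNormOn (closure Ω) (gradClosure Ω u)}

open MeasureTheory

/-! Write M for `lambdaOne Ω` and suppose that the extremal gradient has length less than M at some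
boundary point p. The strong maximum principle for the length of the gradient
(`norm_gradient_lt_of_laplacian_eq`) keeps this length below M inside Ω, so the set K on which M is
attained is a compact part of the boundary that misses p. It suffices to find h, harmonic near the
closure of Ω, with ∇h uniformly close to ∇u on K. Then ∇h makes an acute angle with ∇u wherever M is
attained, and u - t h with small t > 0 is an admissible competitor whose gradient has smaller
supremum (`exists_norm_sub_smul_lt`).

The approximation is of Runge type. The field (x - y) / ‖x - y‖ ^ N is the gradient of a fundamental
solution with pole y, harmonic near the closure of Ω when y lies outside that closure. Since p is
off K, Ω together with a small ball at p is a connected set which avoids K and reaches the exterior.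
As a C(K)-valued map the field is analytic in its pole, so the identity theorem puts the fields with
poles in Ω into the closed span of those with exterior poles. The boundary is null, so this covers
almost every pole (`ae_kernelC_mem_poleSpan`).

The gradient of a test function is an integral of such fields against its Laplacian
(`fderiv_eq_integral_kernel`). Because K is null, poles near K contribute arbitrarily little, and
every test gradient restricted to K lies in the closed span, with no condition on its Laplacian
(`isPoleLimit_fderiv`). Finally u is only C¹ up to the boundary, but near each boundary point a
small transversal translation makes it C² across the boundary. Cutoffs glue these local
approximations (`isPoleLimit_gradClosure`). -/

abbrev Euc (N : ℕ) := EuclideanSpace ℝ (Fin N)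

noncomputable abbrev stdVec {N : ℕ} (i : Fin N) : Euc N := EuclideanSpace.single i (1 : ℝ)

/-! ### Laplacian in coordinates and integration by parts -/

lemma laplacian_eq_sum_fderiv {N : ℕ} (f : Euc N → ℝ) (x : Euc N) :
    Laplacian.laplacian f x = ∑ i, fderiv ℝ (fderiv ℝ f) x (stdVec i) (stdVec i) := by
  rw [InnerProductSpace.laplacian_eq_iteratedFDeriv_orthonormalBasis f
    (EuclideanSpace.basisFun (Fin N) ℝ)]
  simp [iteratedFDeriv_two_apply]

lemma fderiv_fderiv_apply {N : ℕ} {f : Euc N → ℝ} {x : Euc N} (hf : ContDiffAt ℝ 2 f x)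
    (v w : Euc N) :
    fderiv ℝ (fun y => fderiv ℝ f y v) x w = fderiv ℝ (fderiv ℝ f) x w v := by
  have h : DifferentiableAt ℝ (fderiv ℝ f) x :=
    (hf.fderiv_right (m := 1) (by norm_num)).differentiableAt (by norm_num)
  have := (h.hasFDerivAt.clm_apply (hasFDerivAt_const v x)).fderiv
  rw [this]; simp

lemma continuous_laplacian {N : ℕ} {φ : Euc N → ℝ} (hφ : ContDiff ℝ 2 φ) :
    Continuous (Laplacian.laplacian φ) := by
  rw [funext (laplacian_eq_sum_fderiv φ)]
  have h2 := (hφ.fderiv_right (m := 1) (by norm_num)).continuous_fderiv (by norm_num)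
  exact continuous_finsetSum _ fun j _ =>
    (h2.clm_apply continuous_const).clm_apply continuous_const

lemma HasCompactSupport.laplacian {N : ℕ} {φ : Euc N → ℝ} (hφc : HasCompactSupport φ) :
    HasCompactSupport (Laplacian.laplacian φ) := by
  refine HasCompactSupport.intro' hφc (isClosed_tsupport _) fun x hx => ?_
  have : φ =ᶠ[𝓝 x] fun _ => 0 := notMem_tsupport_iff_eventuallyEq.1 hx
  rw [(InnerProductSpace.laplacian_congr_nhds this).self_of_nhds]
  simp

lemma abs_coord_le_norm {N : ℕ} (z : Euc N) (i : Fin N) : |z i| ≤ ‖z‖ := by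
  simpa using PiLp.norm_apply_le z i

lemma integral_mul_fderiv_of_hasCompactSupport {N : ℕ} {f g : Euc N → ℝ} (hf : ContDiff ℝ 1 f)
    (hg : ContDiff ℝ 1 g) (hgc : HasCompactSupport g) (v : Euc N) :
    ∫ x, f x * fderiv ℝ g x v = -∫ x, fderiv ℝ f x v * g x := by
  have hf' : Continuous fun x => fderiv ℝ f x v :=
    (hf.continuous_fderiv (by norm_num)).clm_apply continuous_const
  have hg' : Continuous fun x => fderiv ℝ g x v :=
    (hg.continuous_fderiv (by norm_num)).clm_apply continuous_const
  apply integral_mul_fderiv_eq_neg_fderiv_mul_of_integrable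
  · exact (hf'.mul hg.continuous).integrable_of_hasCompactSupport hgc.mul_left
  · exact (hf.continuous.mul hg').integrable_of_hasCompactSupport
      (HasCompactSupport.mul_left (hgc.fderiv_apply (𝕜 := ℝ) v))
  · exact (hf.continuous.mul hg.continuous).integrable_of_hasCompactSupport hgc.mul_left
  · exact fun x _ => hf.differentiable (by norm_num) x
  · exact fun x _ => hg.differentiable (by norm_num) x

lemma fderiv_mul_coord {N : ℕ} {γ : Euc N → ℝ} {z : Euc N} {m : ℝ}
    (hγ : DifferentiableAt ℝ γ z) (hm : ∀ w, fderiv ℝ γ z w = m * inner ℝ z w) (j k : Fin N) :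
    fderiv ℝ (fun z : Euc N => γ z * z j) z (stdVec k) =
      m * z k * z j + γ z * (if j = k then 1 else 0) := by
  have h1 : HasFDerivAt (fun z : Euc N => z j) (EuclideanSpace.proj j : Euc N →L[ℝ] ℝ) z :=
    (EuclideanSpace.proj j : Euc N →L[ℝ] ℝ).hasFDerivAt
  have := (hγ.hasFDerivAt.mul h1).fderiv
  rw [show (fun z : Euc N => γ z * z j) = γ * fun z : Euc N => z j from rfl, this]
  simp [hm, EuclideanSpace.inner_single_right]
  ring

/-- Double integration by parts against a radial kernel. -/
lemma integral_radial_mul_laplacian {N : ℕ} {γ m φ : Euc N → ℝ} (hγ : ContDiff ℝ 1 γ)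
    (hm : ∀ z w, fderiv ℝ γ z w = m z * inner ℝ z w)
    (hφ : ContDiff ℝ 2 φ) (hφc : HasCompactSupport φ) (i : Fin N) :
    ∫ z, γ z * z i * Laplacian.laplacian φ z =
      -∫ z, (N * γ z + m z * ‖z‖ ^ 2) * fderiv ℝ φ z (stdVec i) := by
  have hq : ∀ j : Fin N, ContDiff ℝ 1 (fun z : Euc N => γ z * z j) := fun j =>
    hγ.mul (EuclideanSpace.proj j : Euc N →L[ℝ] ℝ).contDiff
  have hqd : ∀ (j k : Fin N) (z : Euc N), fderiv ℝ (fun z : Euc N => γ z * z j) z (stdVec k) =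
      m z * z k * z j + γ z * (if j = k then 1 else 0) := fun j k z =>
    fderiv_mul_coord (hγ.differentiable (by norm_num) z) (hm z) j k
  have hd : ∀ j : Fin N, ContDiff ℝ 1 (fun z : Euc N => fderiv ℝ φ z (stdVec j)) := fun j =>
    (hφ.fderiv_right (m := 1) (by norm_num)).clm_apply contDiff_const
  have hdc : ∀ j : Fin N, HasCompactSupport (fun z : Euc N => fderiv ℝ φ z (stdVec j)) := fun j =>
    hφc.fderiv_apply (𝕜 := ℝ) _
  have hdd : ∀ j k : Fin N, Continuous fun z => fderiv ℝ (fderiv ℝ φ) z (stdVec j) (stdVec k) := by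
    intro j k
    have := (hd k).continuous_fderiv (by norm_num)
    have h2 := this.clm_apply (continuous_const (y := (stdVec j : Euc N)))
    simpa only [fderiv_fderiv_apply hφ.contDiffAt] using h2
  have hddc : ∀ j k : Fin N, HasCompactSupport
      fun z => fderiv ℝ (fderiv ℝ φ) z (stdVec j) (stdVec k) := by
    intro j k
    have h2 := (hdc k).fderiv_apply (𝕜 := ℝ) (stdVec j)
    simpa only [fderiv_fderiv_apply hφ.contDiffAt] using h2
  -- The radial field q = γ(z) z is curl-free. Integrate by parts in j, replace ∂_j q_i by ∂_i q_j,
  -- then integrate back in i and once more in j, using symmetry of the Hessian of φ.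
  have key : ∀ j : Fin N, ∫ z, γ z * z i * fderiv ℝ (fderiv ℝ φ) z (stdVec j) (stdVec j) =
      -∫ z, (fderiv ℝ (fun z : Euc N => γ z * z j) z (stdVec j)) * fderiv ℝ φ z (stdVec i) := by
    intro j
    have a1 := integral_mul_fderiv_of_hasCompactSupport (hq i) (hd j) (hdc j) (stdVec j)
    have a2 := integral_mul_fderiv_of_hasCompactSupport (hq j) (hd j) (hdc j) (stdVec i)
    have a3 := integral_mul_fderiv_of_hasCompactSupport (hq j) (hd i) (hdc i) (stdVec j)
    simp only [fderiv_fderiv_apply hφ.contDiffAt] at a1 a2 a3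
    rw [a1, ← a3]
    have hs : ∀ z, fderiv ℝ (fderiv ℝ φ) z (stdVec j) (stdVec i) =
        fderiv ℝ (fderiv ℝ φ) z (stdVec i) (stdVec j) := fun z =>
      (hφ.contDiffAt.isSymmSndFDerivAt (by simp)) _ _
    simp only [hs]
    rw [a2]
    congr 1
    apply integral_congr_ae
    refine ae_of_all _ fun z => ?_
    simp only [hqd]
    rw [show (if i = j then (1 : ℝ) else 0) = if j = i then 1 else 0 by simp [eq_comm]]
    ring
  calc ∫ z, γ z * z i * Laplacian.laplacian φ z
      = ∫ z, ∑ j, γ z * z i * fderiv ℝ (fderiv ℝ φ) z (stdVec j) (stdVec j) := by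
        simp only [laplacian_eq_sum_fderiv, Finset.mul_sum]
    _ = ∑ j, ∫ z, γ z * z i * fderiv ℝ (fderiv ℝ φ) z (stdVec j) (stdVec j) :=
        integral_finsetSum _ fun j _ => ((hq i).continuous.mul (hdd j j)).integrable_of_hasCompactSupport
          (hddc j j).mul_left
    _ = -∑ j, ∫ z, (fderiv ℝ (fun z : Euc N => γ z * z j) z (stdVec j)) *
          fderiv ℝ φ z (stdVec i) := by
        simp only [key, Finset.sum_neg_distrib]
    _ = -∫ z, ∑ j, (fderiv ℝ (fun z : Euc N => γ z * z j) z (stdVec j)) *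
          fderiv ℝ φ z (stdVec i) := by
        rw [integral_finsetSum]
        intro j _
        exact ((((hq j).continuous_fderiv (by norm_num)).clm_apply continuous_const).mul
          (hd i).continuous).integrable_of_hasCompactSupport (hdc i).mul_left
    _ = _ := by
        congr 1
        apply integral_congr_ae
        refine ae_of_all _ fun z => ?_
        -- What remains is the divergence of q, namely N γ + m ‖z‖².
        simp only [hqd, ← Finset.sum_mul]
        congr 1
        rw [EuclideanSpace.real_norm_sq_eq]
        simp [Finset.sum_add_distrib, Finset.mul_sum]
        rw [add_comm]; congr 1
        exact Finset.sum_congr rfl fun j _ => by ring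

/-! ### Local integrability of the singular kernel -/

/-- In polar coordinates the Jacobian r ^ (N - 1) cancels r / r ^ N, leaving the constant 1 on (0,
R). -/
lemma norm_mul_inv_norm_pow_integrableOn {N : ℕ} (hN : 2 ≤ N) (R : ℝ) :
    IntegrableOn (fun z : Euc N => ‖z‖ * (‖z‖ ^ N)⁻¹) (Metric.ball 0 R) := by
  have : Nonempty (Fin N) := ⟨⟨0, by omega⟩⟩
  have : Nontrivial (Euc N) := inferInstance
  have h := (integrable_fun_norm_addHaar (volume : Measure (Euc N))
    (f := (Iio R).indicator fun r : ℝ => r * (r ^ N)⁻¹)).2 ?_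
  · rw [← integrable_indicator_iff Metric.isOpen_ball.measurableSet]
    convert! h using 2 with z
    by_cases hz : ‖z‖ < R <;> simp [hz, indicator]
  · have : IntegrableOn (fun _ : ℝ => (1 : ℝ)) (Ioo 0 R) := by
      rw [integrableOn_const_iff]; simp
    rw [← integrable_indicator_iff measurableSet_Ioo] at this
    rw [← integrable_indicator_iff measurableSet_Ioi]
    refine this.congr (ae_of_all _ fun y => ?_)
    by_cases h0 : 0 < y
    · by_cases h1 : y < R
      · simp only [indicator, mem_Ioo, h0, h1, and_self, if_true, mem_Ioi, mem_Iio, smul_eq_mul,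
          finrank_euclideanSpace_fin]
        obtain ⟨k, rfl⟩ : ∃ k, N = k + 1 := ⟨N - 1, by omega⟩
        simp only [Nat.add_sub_cancel]
        field_simp
        exact pow_succ y k
      · simp [indicator, h1]
    · simp [indicator, h0]

lemma integrable_norm_mul_inv_norm_pow_mul {N : ℕ} (hN : 2 ≤ N) {f : Euc N → ℝ}
    (hf : Continuous f) (hfc : HasCompactSupport f) :
    Integrable (fun z : Euc N => ‖z‖ * (‖z‖ ^ N)⁻¹ * f z) := by
  obtain ⟨R, hR⟩ := hfc.isBounded.subset_ball (0 : Euc N)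
  obtain ⟨C, hC⟩ := hfc.exists_bound_of_continuous hf
  have h1 := norm_mul_inv_norm_pow_integrableOn hN R
  have h2 : IntegrableOn (fun z : Euc N => ‖z‖ * (‖z‖ ^ N)⁻¹ * f z) (Metric.ball 0 R) :=
    Integrable.mul_bdd (c := C) h1 hf.aestronglyMeasurable (ae_of_all _ hC)
  rw [← integrable_indicator_iff Metric.isOpen_ball.measurableSet] at h2
  refine h2.congr (ae_of_all _ fun z => ?_)
  by_cases hz : z ∈ Metric.ball (0 : Euc N) R
  · simp [hz]
  · have : f z = 0 := by
      by_contra h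
      exact hz (hR (subset_tsupport _ h))
    simp [this, indicator]

/-! ### Regularised kernel and its limit -/

/-- The regularised radius `√(‖z‖² + δ²)`. -/
noncomputable def regNorm {N : ℕ} (δ : ℝ) (z : Euc N) : ℝ := √(‖z‖ ^ 2 + δ ^ 2)

section regNorm
variable {N : ℕ} {δ : ℝ}

lemma regNorm_pos (hδ : 0 < δ) (z : Euc N) : 0 < regNorm δ z :=
  Real.sqrt_pos.2 (by positivity)

lemma regNorm_sq (z : Euc N) : regNorm δ z ^ 2 = ‖z‖ ^ 2 + δ ^ 2 :=
  Real.sq_sqrt (by positivity)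

lemma norm_le_regNorm (z : Euc N) : ‖z‖ ≤ regNorm δ z :=
  Real.le_sqrt_of_sq_le (by nlinarith [sq_nonneg δ])

lemma contDiff_regNorm (hδ : 0 < δ) {n : ℕ∞ω} : ContDiff ℝ n (regNorm δ : Euc N → ℝ) := by
  unfold regNorm
  exact ((contDiff_norm_sq ℝ).add contDiff_const).sqrt (fun z => by positivity)

lemma continuous_regNorm_right (δ : ℝ) : Continuous (regNorm δ : Euc N → ℝ) := by
  unfold regNorm; fun_prop

lemma hasFDerivAt_regNorm {z : Euc N} (hp : 0 < regNorm δ z) :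
    HasFDerivAt (regNorm δ : Euc N → ℝ) ((regNorm δ z)⁻¹ • innerSL ℝ z) z := by
  have h1 : HasFDerivAt (fun z : Euc N => ‖z‖ ^ 2 + δ ^ 2) (2 • innerSL ℝ z) z :=
    (hasStrictFDerivAt_norm_sq z).hasFDerivAt.add_const _
  have h2 := h1.sqrt (Real.sqrt_pos.1 hp).ne'
  convert! h2 using 1
  ext w
  simp only [regNorm, one_div, smul_apply, smul_eq_mul, nsmul_eq_mul]
  simp
  ring

lemma hasFDerivAt_inv_regNorm_pow {z : Euc N} (hp : 0 < regNorm δ z) (n : ℕ) :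
    HasFDerivAt (fun z : Euc N => (regNorm δ z ^ n)⁻¹)
      ((-(n : ℝ) * (regNorm δ z ^ (n + 2))⁻¹) • innerSL ℝ z) z := by
  have h1 := (hasFDerivAt_regNorm hp).pow n
  have h2 := (hasDerivAt_inv (pow_pos hp n).ne').comp_hasFDerivAt z h1
  convert! h2 using 1
  rw [smul_smul, smul_smul]
  congr 1
  rcases n with _ | n
  · simp
  · simp only [Nat.add_sub_cancel, nsmul_eq_mul]
    field_simp
    ring

lemma regNorm_inv_smul {c : ℝ} (hc : 0 < c) (z : Euc N) :
    regNorm 1 (c • z) = c * regNorm c⁻¹ z := by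
  unfold regNorm
  rw [← Real.sqrt_sq hc.le, ← Real.sqrt_mul (sq_nonneg c), Real.sqrt_sq hc.le, norm_smul]
  congr 1
  rw [Real.norm_of_nonneg hc.le]; field_simp

lemma integrable_inv_regNorm_pow : Integrable (fun z : Euc N => (regNorm 1 z ^ (N + 2))⁻¹) := by
  have h := integrable_rpow_neg_one_add_norm_sq (E := Euc N) (μ := volume) (r := (N + 2 : ℕ))
    (by simp)
  refine h.congr (ae_of_all _ fun z => ?_)
  simp only [regNorm]
  have h0 : (0 : ℝ) ≤ ‖z‖ ^ 2 + 1 ^ 2 := by positivity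
  rw [Real.sqrt_eq_rpow, ← Real.rpow_natCast (_ ^ _) (N + 2), ← Real.rpow_mul h0, ← Real.rpow_neg h0]
  congr 1
  · ring
  · ring

end regNorm

/-- The mass of the radial kernel (the surface measure of the unit sphere). -/
noncomputable def kernelMass (N : ℕ) : ℝ := ∫ z : Euc N, N * (regNorm 1 z ^ (N + 2))⁻¹

lemma kernelMass_pos {N : ℕ} (hN : 2 ≤ N) : 0 < kernelMass N := by
  unfold kernelMass
  rw [integral_const_mul]
  refine mul_pos (by positivity) ?_
  rw [integral_pos_iff_support_of_nonneg _ integrable_inv_regNorm_pow]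
  · have : Function.support (fun z : Euc N => (regNorm 1 z ^ (N + 2))⁻¹) = univ := by
      ext z
      have := regNorm_pos one_pos z
      simp [this.ne']
    rw [this]; exact Measure.measure_univ_pos.2 (NeZero.ne _)
  · intro z
    have := regNorm_pos one_pos z
    simp only [Pi.zero_apply]; positivity

/-- With δ = 1 / c, the kernel N δ² / (‖z‖² + δ²) ^ ((N + 2) / 2) is c ^ N times the δ = 1 kernel
evaluated at c z. It is therefore an approximate identity of mass `kernelMass N`. -/
lemma tendsto_integral_regNorm_pow {N : ℕ} (hN : 2 ≤ N) {F : Euc N → ℝ} (hF : Continuous F)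
    (hFc : HasCompactSupport F) :
    Tendsto (fun c : ℝ => ∫ z, N * (c⁻¹) ^ 2 * (regNorm c⁻¹ z ^ (N + 2))⁻¹ * F z) atTop
      (𝓝 (kernelMass N * F 0)) := by
  have hC := kernelMass_pos hN
  have h := tendsto_integral_comp_smul_smul_of_integrable (μ := (volume : Measure (Euc N)))
    (φ := fun z => (kernelMass N)⁻¹ * (N * (regNorm 1 z ^ (N + 2))⁻¹)) (g := F)
    (fun z => by have := regNorm_pos one_pos z; positivity)
    (by rw [integral_const_mul]; exact inv_mul_cancel₀ hC.ne') ?_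
    (hF.integrable_of_hasCompactSupport hFc) hF.continuousAt
  · have h2 := h.const_mul (kernelMass N)
    refine h2.congr' ?_
    filter_upwards [eventually_gt_atTop 0] with c hc
    rw [← integral_const_mul]
    refine integral_congr_ae (ae_of_all _ fun z => ?_)
    simp only [smul_eq_mul, finrank_euclideanSpace_fin, regNorm_inv_smul hc]
    have := regNorm_pos (inv_pos.2 hc) z
    generalize regNorm c⁻¹ z = r at *
    field_simp
    ring
  · have h1 : Tendsto (fun z : Euc N => (kernelMass N)⁻¹ * N * (‖z‖ ^ 2)⁻¹)
        (Bornology.cobounded (Euc N)) (𝓝 0) := by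
      have : Tendsto (fun z : Euc N => (‖z‖ ^ 2)⁻¹) (Bornology.cobounded (Euc N)) (𝓝 0) :=
        ((tendsto_pow_atTop (n := 2) (by norm_num)).comp
          tendsto_norm_cobounded_atTop).inv_tendsto_atTop
      simpa using this.const_mul ((kernelMass N)⁻¹ * N)
    refine squeeze_zero' (Eventually.of_forall fun z => ?_) ?_ h1
    · have := regNorm_pos one_pos z; positivity
    · have : ∀ᶠ z : Euc N in Bornology.cobounded (Euc N), 1 ≤ ‖z‖ :=
        tendsto_norm_cobounded_atTop.eventually_ge_atTop 1
      filter_upwards [this] with z hz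
      have h0 : 0 < ‖z‖ := by linarith
      have h3 := norm_le_regNorm (δ := 1) z
      rw [finrank_euclideanSpace_fin]
      have : (regNorm 1 z ^ (N + 2))⁻¹ ≤ (‖z‖ ^ (N + 2))⁻¹ := by gcongr
      calc ‖z‖ ^ N * ((kernelMass N)⁻¹ * (N * (regNorm 1 z ^ (N + 2))⁻¹))
          ≤ ‖z‖ ^ N * ((kernelMass N)⁻¹ * (N * (‖z‖ ^ (N + 2))⁻¹)) := by gcongr
        _ = _ := by rw [pow_add]; field_simp

/-- Dominated convergence: the factor ‖z‖ in the bound on g turns the singularity ‖z‖ ^ (-N) into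
the locally integrable ‖z‖ ^ (1 - N). -/
lemma tendsto_integral_inv_regNorm_pow_mul {N : ℕ} (hN : 2 ≤ N) {f g : Euc N → ℝ}
    (hg : Continuous g) (hf : Continuous f) (hfc : HasCompactSupport f)
    (hgf : ∀ z, |g z| ≤ ‖z‖ * f z) :
    Tendsto (fun c : ℝ => ∫ z, (regNorm c⁻¹ z ^ N)⁻¹ * g z) atTop
      (𝓝 (∫ z, (‖z‖ ^ N)⁻¹ * g z)) := by
  have hg0 : g 0 = 0 := by simpa using hgf 0
  refine tendsto_integral_filter_of_dominated_convergence
    (fun z => ‖z‖ * (‖z‖ ^ N)⁻¹ * f z)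
    (Eventually.of_forall fun c => ?_) (Eventually.of_forall fun c => ae_of_all _ fun z => ?_)
    (integrable_norm_mul_inv_norm_pow_mul hN hf hfc) (ae_of_all _ fun z => ?_)
  · exact (((continuous_regNorm_right c⁻¹).measurable.pow_const N).inv.mul
      hg.measurable).aestronglyMeasurable
  · by_cases hz : z = 0
    · simp [hz, hg0]
    · have h1 := norm_pos_iff.2 hz
      have h2 := norm_le_regNorm (δ := c⁻¹) z
      rw [Real.norm_eq_abs, abs_mul, abs_of_nonneg (inv_nonneg.2 (pow_nonneg (h1.le.trans h2) N))]
      calc _ ≤ (‖z‖ ^ N)⁻¹ * (‖z‖ * f z) := by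
            gcongr
            exact hgf z
        _ = _ := by ring
  · by_cases hz : z = 0
    · simp [hz, hg0]
    · have h2 : Continuous fun δ : ℝ => regNorm δ z := by unfold regNorm; fun_prop
      have h1 : Tendsto (fun c : ℝ => regNorm c⁻¹ z) atTop (𝓝 (regNorm 0 z)) :=
        (h2.tendsto 0).comp tendsto_inv_atTop_zero
      have h0 : regNorm 0 z = ‖z‖ := by simp [regNorm]
      rw [h0] at h1
      exact ((h1.pow N).inv₀ (pow_ne_zero _ (norm_ne_zero_iff.2 hz))).mul_const _

/-! ### Representation of gradients by singular fields -/

/-- A gradient representation formula with a radial weight `χ`. -/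
lemma integral_kernel_mul_laplacian {N : ℕ} (hN : 2 ≤ N) {χ m φ : Euc N → ℝ}
    (hχ : ContDiff ℝ 1 χ) (hmc : Continuous m)
    (hm : ∀ z w, fderiv ℝ χ z w = m z * inner ℝ z w)
    (hφ : ContDiff ℝ 2 φ) (hφc : HasCompactSupport φ) (i : Fin N) :
    ∫ z, (‖z‖ ^ N)⁻¹ * χ z * z i * Laplacian.laplacian φ z =
      -(kernelMass N * (χ 0 * fderiv ℝ φ 0 (stdVec i)) +
        ∫ z, (‖z‖ ^ N)⁻¹ * m z * ‖z‖ ^ 2 * fderiv ℝ φ z (stdVec i)) := by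
  have hd : Continuous (fun z : Euc N => fderiv ℝ φ z (stdVec i)) :=
    (hφ.continuous_fderiv (by norm_num)).clm_apply continuous_const
  have hdc : HasCompactSupport (fun z : Euc N => fderiv ℝ φ z (stdVec i)) :=
    hφc.fderiv_apply (𝕜 := ℝ) _
  have hL := continuous_laplacian hφ
  have hLc := hφc.laplacian
  have hci : Continuous fun z : Euc N => z i := (EuclideanSpace.proj i : Euc N →L[ℝ] ℝ).continuous
  have t1 := tendsto_integral_inv_regNorm_pow_mul hN (g := fun z => χ z * z i * Laplacian.laplacian φ z)
    (f := fun z => |χ z * Laplacian.laplacian φ z|) ((hχ.continuous.mul hci).mul hL)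
    (hχ.continuous.mul hL).abs ((hLc.mul_left (f := χ)).comp_left abs_zero) (fun z => by
      rw [abs_mul, abs_mul, abs_mul]
      calc _ ≤ |χ z| * ‖z‖ * |Laplacian.laplacian φ z| := by gcongr; exact abs_coord_le_norm z i
        _ = _ := by ring)
  have t2 := tendsto_integral_inv_regNorm_pow_mul hN
    (g := fun z => m z * ‖z‖ ^ 2 * fderiv ℝ φ z (stdVec i))
    (f := fun z => |m z * ‖z‖ * fderiv ℝ φ z (stdVec i)|) ((hmc.mul (continuous_norm.pow 2)).mul hd)
    ((hmc.mul continuous_norm).mul hd).abs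
    ((hdc.mul_left (f := fun z => m z * ‖z‖)).comp_left abs_zero) (fun z => by
      simp only [abs_mul, abs_norm, abs_pow]
      exact le_of_eq (by ring))
  simp only [← mul_assoc] at t1 t2
  have t3 := tendsto_integral_regNorm_pow hN (hχ.continuous.mul hd) (hdc.mul_left (f := χ))
  refine tendsto_nhds_unique t1 ((t3.add t2).neg.congr' ?_)
  filter_upwards [eventually_gt_atTop 0] with c hc
  have hδ : 0 < c⁻¹ := inv_pos.2 hc
  have hγ : ContDiff ℝ 1 (fun z : Euc N => (regNorm c⁻¹ z ^ N)⁻¹ * χ z) :=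
    (((contDiff_regNorm hδ).pow N).inv fun z => (pow_pos (regNorm_pos hδ z) N).ne').mul hχ
  have hdγ : ∀ z w : Euc N, fderiv ℝ (fun z : Euc N => (regNorm c⁻¹ z ^ N)⁻¹ * χ z) z w =
      (-(N : ℝ) * (regNorm c⁻¹ z ^ (N + 2))⁻¹ * χ z + (regNorm c⁻¹ z ^ N)⁻¹ * m z) *
        inner ℝ z w := by
    intro z w
    have h2 := ((hasFDerivAt_inv_regNorm_pow (regNorm_pos hδ z) N).mul
      (hχ.differentiable (by norm_num) z).hasFDerivAt).fderiv
    rw [show (fun z : Euc N => (regNorm c⁻¹ z ^ N)⁻¹ * χ z) =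
      (fun z : Euc N => (regNorm c⁻¹ z ^ N)⁻¹) * χ from rfl, h2]
    simp [hm]
    ring
  rw [integral_radial_mul_laplacian hγ hdγ hφ hφc i, ← integral_add]
  · congr 1
    refine integral_congr_ae (ae_of_all _ fun z => ?_)
    have hp := regNorm_pos hδ z
    have hsq := regNorm_sq (δ := c⁻¹) z
    -- This identity rewrites the divergence N ρ^(-N) - N ‖z‖² ρ^(-N-2) of the regularised field as
    -- N δ² ρ^(-N-2), where ρ is the regularised radius and δ = 1 / c. This is the approximate
    -- identity producing the value at 0.
    have e1 : (regNorm c⁻¹ z ^ N)⁻¹ = (‖z‖ ^ 2 + c⁻¹ ^ 2) * (regNorm c⁻¹ z ^ (N + 2))⁻¹ := by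
      rw [← hsq]; generalize regNorm c⁻¹ z = ρ at hp; field_simp; ring
    simp only [e1, Pi.mul_apply]
    ring
  · refine (Continuous.integrable_of_hasCompactSupport ?_ (hdc.mul_left (f := χ)).mul_left)
    exact (continuous_const.mul (((continuous_regNorm_right c⁻¹).pow _).inv₀
      fun z => (pow_pos (regNorm_pos hδ z) _).ne')).mul (hχ.continuous.mul hd)
  · refine (Continuous.integrable_of_hasCompactSupport ?_ hdc.mul_left)
    exact (((((continuous_regNorm_right c⁻¹).pow _).inv₀
      fun z => (pow_pos (regNorm_pos hδ z) _).ne').mul hmc).mul (continuous_norm.pow 2)).mul hd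

lemma fderiv_fderiv_comp_add_left {N : ℕ} (φ : Euc N → ℝ) (x z : Euc N) :
    fderiv ℝ (fderiv ℝ fun y => φ (x + y)) z = fderiv ℝ (fderiv ℝ φ) (x + z) := by
  have h : (fderiv ℝ fun y => φ (x + y)) = fun y => fderiv ℝ φ (x + y) :=
    funext fun y => fderiv_comp_add_left x
  rw [h, fderiv_comp_add_left]

lemma laplacian_comp_add_left {N : ℕ} (φ : Euc N → ℝ) (x z : Euc N) :
    Laplacian.laplacian (fun y => φ (x + y)) z = Laplacian.laplacian φ (x + z) := by
  simp only [laplacian_eq_sum_fderiv, fderiv_fderiv_comp_add_left]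

/-- The representation of the gradient of a test function as a superposition of the
singular harmonic fields `(x - y) / ‖x - y‖ ^ N`. -/
lemma fderiv_eq_integral_kernel {N : ℕ} (hN : 2 ≤ N) {φ : Euc N → ℝ}
    (hφ : ContDiff ℝ 2 φ) (hφc : HasCompactSupport φ) (x : Euc N) (i : Fin N) :
    ∫ y, Laplacian.laplacian φ y * ((x i - y i) * (‖x - y‖ ^ N)⁻¹) =
      kernelMass N * fderiv ℝ φ x (stdVec i) := by
  have h := integral_kernel_mul_laplacian hN (χ := fun _ => 1) (m := fun _ => 0)
    (φ := fun y => φ (x + y)) contDiff_const continuous_const (by simp)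
    (hφ.comp (contDiff_const.add contDiff_id)) (hφc.comp_homeomorph (Homeomorph.addLeft x)) i
  simp only [laplacian_comp_add_left, fderiv_comp_add_left] at h
  simp only [mul_one, mul_zero, zero_mul, integral_zero, add_zero, one_mul] at h
  rw [← integral_add_left_eq_self _ x, ← neg_inj, ← integral_neg, ← h]
  refine integral_congr_ae (ae_of_all _ fun z => ?_)
  simp
  ring

/-! ### Gradients in coordinates and the strong maximum principle -/

lemma gradient_apply_eq {N : ℕ} (u : Euc N → ℝ) (x : Euc N) (i : Fin N) :
    (∇ u x) i = fderiv ℝ u x (stdVec i) := by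
  have : inner ℝ (∇ u x) (stdVec i) = fderiv ℝ u x (stdVec i) := by
    simp [gradient]
  rw [← this, EuclideanSpace.inner_single_right]
  simp

lemma inner_gradient_eq {N : ℕ} (u : Euc N → ℝ) (x w : Euc N) :
    inner ℝ (∇ u x) w = fderiv ℝ u x w := by
  simp [gradient]

lemma ContDiffOn.contDiff_mul_of_tsupport_subset {N : ℕ} {n : ℕ∞ω} {κ f : Euc N → ℝ}
    {O : Set (Euc N)} (hO : IsOpen O) (hκ : ContDiff ℝ n κ) (hf : ContDiffOn ℝ n f O)
    (hs : tsupport κ ⊆ O) : ContDiff ℝ n (fun x => κ x * f x) := by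
  rw [contDiff_iff_contDiffAt]
  intro x
  by_cases hx : x ∈ O
  · exact hκ.contDiffAt.mul (hf.contDiffAt (hO.mem_nhds hx))
  · have : κ =ᶠ[𝓝 x] fun _ => 0 := notMem_tsupport_iff_eventuallyEq.1 fun h => hx (hs h)
    refine (contDiffAt_const (c := (0 : ℝ))).congr_of_eventuallyEq ?_
    filter_upwards [this] with y hy
    simp [hy]

/-- Compose the antiderivative P of max(0, ·), which is C¹ and vanishes for t ≤ 0, with r² - ‖z‖².
The strict sign of m inside the ball makes the weight in the mean value property definite. -/
lemma exists_radial_weight {N : ℕ} {r : ℝ} :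
    ∃ χ m : Euc N → ℝ, ContDiff ℝ 1 χ ∧ Continuous m ∧
      (∀ z w, fderiv ℝ χ z w = m z * inner ℝ z w) ∧ (∀ z, m z ≤ 0) ∧
      (∀ z, χ (-z) = χ z) ∧ (∀ z, ‖z‖ < r → m z < 0) ∧
      (∀ z, r ≤ ‖z‖ → χ z = 0 ∧ m z = 0) := by
  rcases le_or_gt r 0 with hr | hr
  · exact ⟨fun _ => 0, fun _ => 0, contDiff_const, continuous_const, by simp, by simp, by simp,
      fun z hz => absurd (hz.trans_le hr) (not_lt.2 (norm_nonneg z)), by simp⟩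
  let P : ℝ → ℝ := fun t => ∫ s in (0 : ℝ)..t, max 0 s
  have hPd : ∀ t, HasDerivAt P (max 0 t) t := fun t =>
    intervalIntegral.integral_hasDerivAt_right
      ((continuous_const.max continuous_id).intervalIntegrable _ _)
      (continuous_const.max continuous_id).aestronglyMeasurable.stronglyMeasurableAtFilter
      (continuous_const.max continuous_id).continuousAt
  have hP0 : ∀ t ≤ 0, P t = 0 := by
    intro t ht
    have : P t = ∫ s in (0 : ℝ)..t, (0 : ℝ) := by
      refine intervalIntegral.integral_congr fun s hs => ?_
      rw [uIcc_of_ge ht] at hs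
      exact max_eq_left hs.2
    simpa using this
  have hPc : ContDiff ℝ 1 P := by
    rw [contDiff_one_iff_deriv]
    refine ⟨fun t => (hPd t).differentiableAt, ?_⟩
    rw [funext fun t => (hPd t).deriv]
    exact continuous_const.max continuous_id
  refine ⟨fun z => P (r ^ 2 - ‖z‖ ^ 2), fun z => -2 * max 0 (r ^ 2 - ‖z‖ ^ 2),
    hPc.comp (contDiff_const.sub (contDiff_norm_sq ℝ)), by fun_prop, fun z w => ?_,
    fun z => ?_, fun z => by simp, fun z hz => ?_, fun z hz => ?_⟩
  · have h1 : HasFDerivAt (fun z : Euc N => r ^ 2 - ‖z‖ ^ 2) (-(2 • innerSL ℝ z)) z :=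
      (hasStrictFDerivAt_norm_sq z).hasFDerivAt.const_sub _
    have h2 := ((hPd (r ^ 2 - ‖z‖ ^ 2)).comp_hasFDerivAt z h1).fderiv
    rw [show (fun z : Euc N => P (r ^ 2 - ‖z‖ ^ 2)) = P ∘ fun z : Euc N => r ^ 2 - ‖z‖ ^ 2 from rfl,
      h2]
    simp
    ring
  · have := le_max_left 0 (r ^ 2 - ‖z‖ ^ 2)
    linarith
  · have : 0 < r ^ 2 - ‖z‖ ^ 2 := by nlinarith [norm_nonneg z]
    have := this.trans_le (le_max_right 0 (r ^ 2 - ‖z‖ ^ 2))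
    linarith
  · have : r ^ 2 - ‖z‖ ^ 2 ≤ 0 := by nlinarith [norm_nonneg z]
    exact ⟨hP0 _ this, by simp [max_eq_left this]⟩

/-- Mean value property for the gradient of a function with constant Laplacian. -/
lemma integral_weight_mul_fderiv_eq_zero {N : ℕ} (hN : 2 ≤ N) {χ m φ : Euc N → ℝ} {r c : ℝ}
    (hχ : ContDiff ℝ 1 χ) (hmc : Continuous m)
    (hm : ∀ z w, fderiv ℝ χ z w = m z * inner ℝ z w) (heven : ∀ z, χ (-z) = χ z)
    (h0 : ∀ z, r ≤ ‖z‖ → χ z = 0)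
    (hφ : ContDiff ℝ 2 φ) (hφc : HasCompactSupport φ)
    (hL : ∀ z, ‖z‖ < r → Laplacian.laplacian φ z = c) (hφ0 : fderiv ℝ φ 0 = 0) (i : Fin N) :
    ∫ z, (‖z‖ ^ N)⁻¹ * m z * ‖z‖ ^ 2 * fderiv ℝ φ z (stdVec i) = 0 := by
  have h := integral_kernel_mul_laplacian hN hχ hmc hm hφ hφc i
  have h1 : ∀ z : Euc N, (‖z‖ ^ N)⁻¹ * χ z * z i * Laplacian.laplacian φ z =
      (‖z‖ ^ N)⁻¹ * χ z * z i * c := by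
    intro z
    rcases lt_or_ge ‖z‖ r with hz | hz
    · rw [hL z hz]
    · simp [h0 z hz]
  simp only [h1, hφ0] at h
  -- The integrand is odd, so the Laplacian term drops out.
  have h2 : ∫ z : Euc N, (‖z‖ ^ N)⁻¹ * χ z * z i * c = 0 := by
    have h3 := integral_neg_eq_self (fun z : Euc N => (‖z‖ ^ N)⁻¹ * χ z * z i * c) volume
    have h4 : ∀ z : Euc N, (‖-z‖ ^ N)⁻¹ * χ (-z) * (-z) i * c =
        -((‖z‖ ^ N)⁻¹ * χ z * z i * c) := by
      intro z; rw [heven, norm_neg]; simp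
    simp only [h4] at h3
    rw [integral_neg] at h3
    linarith
  rw [h2] at h
  simp at h
  exact h

/-- Strong maximum principle for the length of the gradient. -/
theorem norm_gradient_lt_of_laplacian_eq {N : ℕ} (hN : 2 ≤ N) {Ω : Set (Euc N)} (hΩ : IsOpen Ω)
    {u : Euc N → ℝ} (hu : ContDiffOn ℝ 2 u Ω) {c : ℝ} (hc : c ≠ 0)
    (hL : ∀ x ∈ Ω, Laplacian.laplacian u x = c) {M : ℝ} (hM : ∀ x ∈ Ω, ‖∇ u x‖ ≤ M)
    {p : Euc N} (hp : p ∈ Ω) : ‖∇ u p‖ < M := by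
  refine lt_of_le_of_ne (hM p hp) fun hEq => ?_
  obtain ⟨R, hR, hRΩ⟩ := Metric.isOpen_iff.1 hΩ p hp
  set r := R / 3 with hr
  have hr0 : 0 < r := by positivity
  set a := ∇ u p with ha
  -- Subtracting the linear function ⟪a, ·⟫ makes the gradient vanish at 0 and does not change the
  -- Laplacian.
  let f : Euc N → ℝ := fun z => u (p + z) - inner ℝ a z
  have hmem : ∀ z : Euc N, ‖z‖ < R → p + z ∈ Ω := fun z hz => hRΩ (by simpa using hz)
  have hfC : ContDiffOn ℝ 2 f (Metric.ball 0 R) := by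
    refine ContDiffOn.sub ?_ (innerSL ℝ a).contDiff.contDiffOn
    exact hu.comp (contDiff_const.add contDiff_id).contDiffOn fun z hz => hmem z (by simpa using hz)
  have hfd : ∀ z, ‖z‖ < R → fderiv ℝ f z = fderiv ℝ u (p + z) - innerSL ℝ a := by
    intro z hz
    have h1 : DifferentiableAt ℝ u (p + z) :=
      (hu.contDiffAt (hΩ.mem_nhds (hmem z hz))).differentiableAt (by norm_num)
    have h2 : HasFDerivAt (fun z => u (p + z)) (fderiv ℝ u (p + z)) z :=
      (hasFDerivAt_comp_add_left p).2 h1.hasFDerivAt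
    exact (h2.sub (innerSL ℝ a).hasFDerivAt).fderiv
  let κ : ContDiffBump (0 : Euc N) := ⟨r, 2 * r, hr0, by linarith⟩
  let φ : Euc N → ℝ := fun z => κ z * f z
  have hφ : ContDiff ℝ 2 φ := by
    refine hfC.contDiff_mul_of_tsupport_subset Metric.isOpen_ball κ.contDiff ?_
    rw [κ.tsupport_eq]
    exact Metric.closedBall_subset_ball (by simp only [κ]; linarith)
  have hφc : HasCompactSupport φ := κ.hasCompactSupport.mul_right
  have hφf : ∀ z, ‖z‖ < r → φ =ᶠ[𝓝 z] f := by
    intro z hz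
    filter_upwards [Metric.isOpen_ball.mem_nhds (mem_ball_zero_iff.2 hz)] with y hy
    have : κ y = 1 := κ.one_of_mem_closedBall (Metric.ball_subset_closedBall hy)
    simp [φ, this]
  have hφd : ∀ z, ‖z‖ < r → fderiv ℝ φ z = fderiv ℝ u (p + z) - innerSL ℝ a := fun z hz => by
    rw [(hφf z hz).fderiv_eq, hfd z (by linarith)]
  have hφL : ∀ z, ‖z‖ < r → Laplacian.laplacian φ z = c := by
    intro z hz
    rw [← hL _ (hmem z (by linarith)), laplacian_eq_sum_fderiv, laplacian_eq_sum_fderiv]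
    have h1 : fderiv ℝ φ =ᶠ[𝓝 z] fun y => fderiv ℝ u (p + y) - innerSL ℝ a := by
      filter_upwards [Metric.isOpen_ball.mem_nhds (mem_ball_zero_iff.2 hz)] with y hy
      exact hφd y (by simpa using hy)
    rw [h1.fderiv_eq, fderiv_sub_const, fderiv_comp_add_left]
  obtain ⟨χ, m, hχ, hmc, hm, hm0, heven, hneg, hout⟩ := exists_radial_weight (N := N) (r := r)
  have hφ0 : fderiv ℝ φ 0 = 0 := by
    rw [hφd 0 (by simpa using hr0)]
    ext w
    simp [ha]
  have key := integral_weight_mul_fderiv_eq_zero hN hχ hmc hm heven (fun z hz => (hout z hz).1)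
    hφ hφc hφL hφ0
  have hint : ∀ v : Euc N, Integrable
      (fun z => (‖z‖ ^ N)⁻¹ * m z * ‖z‖ ^ 2 * fderiv ℝ φ z v) := by
    intro v
    have hd : Continuous (fun z : Euc N => fderiv ℝ φ z v) :=
      (hφ.continuous_fderiv (by norm_num)).clm_apply continuous_const
    have hdc : HasCompactSupport (fun z : Euc N => fderiv ℝ φ z v) := hφc.fderiv_apply (𝕜 := ℝ) _
    refine (integrable_norm_mul_inv_norm_pow_mul hN ((hmc.mul continuous_norm).mul hd)
      hdc.mul_left).congr (ae_of_all _ fun z => ?_)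
    simp only [Pi.mul_apply]
    ring
  have hsum : ∫ z, (‖z‖ ^ N)⁻¹ * m z * ‖z‖ ^ 2 * fderiv ℝ φ z a = 0 := by
    have h1 : ∀ z, (‖z‖ ^ N)⁻¹ * m z * ‖z‖ ^ 2 * fderiv ℝ φ z a =
        ∑ i, a i * ((‖z‖ ^ N)⁻¹ * m z * ‖z‖ ^ 2 * fderiv ℝ φ z (stdVec i)) := by
      intro z
      have h2 : a = ∑ i, a i • (stdVec i : Euc N) := by
        simpa using ((EuclideanSpace.basisFun (Fin N) ℝ).sum_repr a).symm
      conv_lhs => rw [h2]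
      simp only [map_sum, map_smul, smul_eq_mul, Finset.mul_sum]
      exact Finset.sum_congr rfl fun i _ => by ring
    simp only [h1]
    rw [integral_finsetSum _ fun i _ => (hint _).const_mul _]
    simp only [integral_const_mul, key]
    simp
  -- Cauchy–Schwarz: ‖a‖ = M is the largest gradient length, so ⟪∇u(p + z) - a, a⟫ ≤ 0.
  have hle : ∀ z, ‖z‖ < r → fderiv ℝ φ z a ≤ 0 := by
    intro z hz
    rw [hφd z hz, sub_apply, ← inner_gradient_eq]
    have h1 := real_inner_le_norm (∇ u (p + z)) a
    have h2 := hM _ (hmem z (by linarith))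
    have h3 : inner ℝ a a = ‖a‖ ^ 2 := real_inner_self_eq_norm_sq a
    simp only [innerSL_apply_apply, h3]
    rw [← hEq] at h2
    nlinarith [norm_nonneg a]
  have hnn : 0 ≤ fun z => (‖z‖ ^ N)⁻¹ * m z * ‖z‖ ^ 2 * fderiv ℝ φ z a := by
    intro z
    rcases lt_or_ge ‖z‖ r with hz | hz
    · have := mul_nonneg_of_nonpos_of_nonpos (hm0 z) (hle z hz)
      calc (0 : ℝ) ≤ (‖z‖ ^ N)⁻¹ * ‖z‖ ^ 2 * (m z * fderiv ℝ φ z a) := by positivity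
        _ = _ := by ring
    · simp [hout z hz]
  have hae := (integral_eq_zero_iff_of_nonneg hnn (hint a)).1 hsum
  -- At 0 the weight vanishes and gives no information, so the centre is removed.
  let A : Set (Euc N) := Metric.ball 0 r ∩ {0}ᶜ
  have hA : IsOpen A := Metric.isOpen_ball.inter isOpen_compl_singleton
  have hAeq : EqOn (fun z => fderiv ℝ φ z a) (fun _ => 0) A := by
    refine Measure.eqOn_open_of_ae_eq (μ := volume) ?_ hA
      ((hφ.continuous_fderiv (by norm_num)).clm_apply continuous_const).continuousOn
      continuousOn_const
    rw [EventuallyEq, ae_restrict_iff' hA.measurableSet]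
    filter_upwards [hae] with z hz hzA
    have h1 : 0 < ‖z‖ := norm_pos_iff.2 hzA.2
    have h2 := hneg z (by simpa using hzA.1)
    simp only [Pi.zero_apply, mul_eq_zero] at hz
    have h3 : (‖z‖ ^ N)⁻¹ ≠ 0 := by positivity
    have h4 : ‖z‖ ^ 2 ≠ 0 := by positivity
    simpa [h3, h4, h2.ne] using hz
  have hfd0 : ∀ z ∈ A, fderiv ℝ φ z = 0 := by
    intro z hz
    have hzr : ‖z‖ < r := by simpa using hz.1
    have h1 := hAeq hz
    simp only [hφd z hzr, sub_apply, ← inner_gradient_eq,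
      innerSL_apply_apply] at h1
    have h2 := hM _ (hmem z (by linarith))
    rw [← hEq] at h2
    -- Equality in Cauchy–Schwarz together with ‖∇u(p + z)‖ ≤ ‖a‖. The gradient of u is then locally
    -- constant, which contradicts c ≠ 0.
    have h3 : ∇ u (p + z) = a := by
      rw [← sub_eq_zero, ← norm_eq_zero]
      have h4 := norm_sub_sq_real (∇ u (p + z)) a
      have h5 : inner ℝ a a = ‖a‖ ^ 2 := real_inner_self_eq_norm_sq a
      have h6 : ‖∇ u (p + z) - a‖ ^ 2 ≤ 0 := by nlinarith [norm_nonneg (∇ u (p + z))]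
      exact pow_eq_zero_iff (two_ne_zero) |>.1 (le_antisymm h6 (sq_nonneg _))
    rw [hφd z hzr]
    ext w
    simp [← inner_gradient_eq, h3]
  obtain ⟨z, hz⟩ : A.Nonempty := by
    refine ⟨(r / 2) • stdVec ⟨0, by omega⟩, ?_, ?_⟩
    · simp [norm_smul, abs_of_pos hr0, hr0]
    · simp [hr0.ne']
  refine hc ?_
  rw [← hφL z (by simpa using hz.1), laplacian_eq_sum_fderiv]
  have h1 : fderiv ℝ φ =ᶠ[𝓝 z] fun _ => 0 := by
    filter_upwards [hA.mem_nhds hz] with y hy using hfd0 y hy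
  rw [h1.fderiv_eq]
  simp

/-! ### Transversal directions and nullity of the boundary -/

lemma lt_of_fderiv_neg_on_ball {N : ℕ} {ρ : Euc N → ℝ} {p v : Euc N} {s : ℝ}
    (hd : ∀ y ∈ Metric.ball p s, DifferentiableAt ℝ ρ y)
    (hneg : ∀ y ∈ Metric.ball p s, fderiv ℝ ρ y v < 0) {x : Euc N} {t : ℝ} (ht : 0 < t)
    (hx : x ∈ Metric.ball p s) (hxt : x + t • v ∈ Metric.ball p s) : ρ (x + t • v) < ρ x := by
  have hmem : ∀ τ ∈ Icc (0 : ℝ) t, x + τ • v ∈ Metric.ball p s := by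
    intro τ hτ
    have := (convex_ball p s).add_smul_sub_mem hx hxt
      (t := τ / t) ⟨div_nonneg hτ.1 ht.le, div_le_one_of_le₀ hτ.2 ht.le⟩
    rwa [add_sub_cancel_left, smul_smul, div_mul_cancel₀ _ ht.ne'] at this
  have hder : ∀ τ ∈ Icc (0 : ℝ) t, HasDerivAt (fun τ : ℝ => ρ (x + τ • v))
      (fderiv ℝ ρ (x + τ • v) v) τ := by
    intro τ hτ
    have h1 : HasDerivAt (fun τ : ℝ => x + τ • v) v τ := by
      simpa using ((hasDerivAt_id τ).smul_const v).const_add x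
    exact (hd _ (hmem τ hτ)).hasFDerivAt.comp_hasDerivAt τ h1
  have := strictAntiOn_of_deriv_neg (convex_Icc 0 t) (f := fun τ : ℝ => ρ (x + τ • v))
    (fun τ hτ => (hder τ hτ).continuousAt.continuousWithinAt) (fun τ hτ => by
      have hτ' := interior_subset hτ
      rw [(hder τ hτ').deriv]
      exact hneg _ (hmem τ hτ'))
  simpa using this (left_mem_Icc.2 ht.le) (right_mem_Icc.2 ht.le) ht

/-- Near a boundary point of a smooth domain there is a direction which is transversal to the
boundary. -/
lemma IsSmoothBoundedDomain.exists_transversal {N : ℕ} {Ω : Set (Euc N)}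
    (hΩ : IsSmoothBoundedDomain Ω) {p : Euc N} (hp : p ∈ frontier Ω) :
    ∃ v : Euc N, ∃ r : ℝ, 0 < r ∧ ∀ x ∈ Metric.ball p r, ∀ t : ℝ, 0 < t → t < r →
      (x ∈ closure Ω → x + t • v ∈ Ω) ∧ (x ∉ Ω → x - t • v ∉ closure Ω) := by
  obtain ⟨U, ρ, hU, hpU, hρ, hne, hΩU⟩ := hΩ.smooth_boundary p hp
  obtain ⟨w, hw⟩ : ∃ w, fderiv ℝ ρ p w ≠ 0 := by
    by_contra! h
    exact hne (ContinuousLinearMap.ext h)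
  -- The factor makes the derivative of ρ along v equal to minus a nonzero square, so v points into
  -- Ω.
  set v := -(fderiv ℝ ρ p w) • w with hv
  have hvneg : fderiv ℝ ρ p v < 0 := by
    rw [hv, map_smul, smul_eq_mul]
    nlinarith [mul_self_pos.2 hw]
  have hcont : ContinuousOn (fun y => fderiv ℝ ρ y v) U :=
    (hρ.continuousOn_fderiv_of_isOpen hU (by simp)).clm_apply continuousOn_const
  have hev : ∀ᶠ y in 𝓝 p, y ∈ U ∧ fderiv ℝ ρ y v < 0 :=
    Filter.Eventually.and (hU.mem_nhds hpU) ((hcont.continuousAt (hU.mem_nhds hpU)).eventually_lt_const hvneg)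
  obtain ⟨s, hs, hball⟩ := Metric.eventually_nhds_iff_ball.1 hev
  have hd : ∀ y ∈ Metric.ball p s, DifferentiableAt ℝ ρ y := fun y hy =>
    (hρ.contDiffAt (hU.mem_nhds (hball y hy).1)).differentiableAt (by simp)
  have hcl : ∀ x ∈ U, x ∈ closure Ω → ρ x ≤ 0 := by
    intro x hxU hx
    by_contra! hpos
    have h1 : ∀ᶠ y in 𝓝 x, y ∈ U ∧ 0 < ρ y :=
      Filter.Eventually.and (hU.mem_nhds hxU) ((hρ.continuousOn.continuousAt (hU.mem_nhds hxU)).eventually_const_lt hpos)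
    obtain ⟨y, ⟨hyU, hy⟩, hyΩ⟩ := mem_closure_iff_nhds.1 hx _ h1
    have h2 : y ∈ {x ∈ U | ρ x < 0} := hΩU ▸ ⟨hyΩ, hyU⟩
    exact lt_asymm hy h2.2
  have hout : ∀ x ∈ U, x ∉ Ω → 0 ≤ ρ x := by
    intro x hxU hx
    by_contra! hneg
    have h2 : x ∈ Ω ∩ U := hΩU ▸ ⟨hxU, hneg⟩
    exact hx h2.1
  have hv1 : 0 < ‖v‖ + 1 := by positivity
  refine ⟨v, min (s / 2) (s / (2 * (‖v‖ + 1))), by positivity, fun x hx t ht htr => ?_⟩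
  have hx1 : dist x p < s / 2 := (Metric.mem_ball.1 hx).trans_le (min_le_left _ _)
  have htv : ‖t • v‖ < s / 2 := by
    have h1 : t < s / (2 * (‖v‖ + 1)) := htr.trans_le (min_le_right _ _)
    rw [lt_div_iff₀ (by positivity)] at h1
    rw [norm_smul, Real.norm_of_nonneg ht.le]
    nlinarith
  have hxs : x ∈ Metric.ball p s := Metric.mem_ball.2 (by linarith)
  have hadd : x + t • v ∈ Metric.ball p s := by
    rw [Metric.mem_ball, dist_eq_norm] at *
    calc ‖x + t • v - p‖ = ‖(x - p) + t • v‖ := by congr 1; abel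
      _ ≤ ‖x - p‖ + ‖t • v‖ := norm_add_le _ _
      _ < s := by linarith
  have hsub : x - t • v ∈ Metric.ball p s := by
    rw [Metric.mem_ball, dist_eq_norm] at *
    calc ‖x - t • v - p‖ = ‖(x - p) - t • v‖ := by congr 1; abel
      _ ≤ ‖x - p‖ + ‖t • v‖ := norm_sub_le _ _
      _ < s := by linarith
  have hneg : ∀ y ∈ Metric.ball p s, fderiv ℝ ρ y v < 0 := fun y hy => (hball y hy).2
  refine ⟨fun hxc => ?_, fun hxo hxc => ?_⟩
  · have h1 := lt_of_fderiv_neg_on_ball hd hneg ht hxs hadd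
    have h2 := hcl x (hball x hxs).1 hxc
    have h3 : x + t • v ∈ Ω ∩ U := hΩU ▸ ⟨(hball _ hadd).1, h1.trans_le h2⟩
    exact h3.1
  · have h1 := lt_of_fderiv_neg_on_ball hd hneg ht hsub (by simpa using hxs)
    have h2 := hcl _ (hball _ hsub).1 hxc
    have h3 := hout x (hball x hxs).1 hxo
    rw [sub_add_cancel] at h1
    linarith

/-- Small positive transversal shifts carry boundary points into Ω. A boundary piece thus has
infinitely many pairwise disjoint translates by a bounded set of vectors, which forces measure zero.
-/
lemma IsSmoothBoundedDomain.volume_frontier {N : ℕ} {Ω : Set (Euc N)}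
    (hΩ : IsSmoothBoundedDomain Ω) : volume (frontier Ω) = 0 := by
  refine measure_null_of_locally_null _ fun p hp => ?_
  obtain ⟨v, r, hr, h⟩ := hΩ.exists_transversal hp
  refine ⟨frontier Ω ∩ Metric.closedBall p (r / 2), inter_mem_nhdsWithin _
    (Metric.closedBall_mem_nhds _ (by positivity)), ?_⟩
  have hkey : ∀ a ∈ frontier Ω ∩ Metric.closedBall p (r / 2), ∀ t, 0 < t → t < r →
      a + t • v ∉ frontier Ω := by
    intro a ha t ht htr hf
    have h1 := (h a (Metric.closedBall_subset_ball (by linarith) ha.2) t ht htr).1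
      (frontier_subset_closure ha.1)
    rw [hΩ.isOpen.frontier_eq] at hf
    exact hf.2 h1
  -- The shifts r / (n + 2) are distinct and lie in (0, r), so their positive differences are also
  -- admissible for `hkey`.
  have htpos : ∀ n : ℕ, 0 < r / (n + 2) := fun n => by positivity
  have htlt : ∀ n : ℕ, r / (n + 2) < r := fun n => div_lt_self hr (by
    have : (0 : ℝ) ≤ n := n.cast_nonneg
    linarith)
  refine Measure.addHaar_eq_zero_of_disjoint_translates volume (fun n : ℕ => (r / (n + 2)) • v)
    ?_ ?_ (isClosed_frontier.inter Metric.isClosed_closedBall).measurableSet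
  · refine isBounded_iff_forall_norm_le.2 ⟨r * ‖v‖, ?_⟩
    rintro _ ⟨n, rfl⟩
    rw [norm_smul, Real.norm_of_nonneg (htpos n).le]
    gcongr
    exact (htlt n).le
  · intro m n hmn
    have hsep : ∀ a ∈ frontier Ω ∩ Metric.closedBall p (r / 2),
        ∀ b ∈ frontier Ω ∩ Metric.closedBall p (r / 2), ∀ m n : ℕ, r / (m + 2) < r / (n + 2) →
        (r / (m + 2)) • v + a ≠ (r / (n + 2)) • v + b := by
      intro a ha b hb m n hlt he
      refine hkey b hb (r / (n + 2) - r / (m + 2)) (by linarith)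
        (by linarith [htlt n, htpos m]) ?_
      have : b + (r / (n + 2) - r / (m + 2)) • v = a := by
        rw [sub_smul, add_sub, add_comm b, ← he]; abel
      rw [this]; exact ha.1
    refine Set.disjoint_left.2 ?_
    rintro x hx hx'
    simp only [singleton_add] at hx hx'
    obtain ⟨a, ha, rfl⟩ := hx
    obtain ⟨b, hb, hab⟩ := hx'
    have hne : r / ((m : ℝ) + 2) ≠ r / (n + 2) := by
      intro he
      rw [div_eq_div_iff (by positivity) (by positivity)] at he
      exact hmn (by exact_mod_cast (add_right_cancel (mul_left_cancel₀ hr.ne' he)).symm)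
    rcases lt_or_gt_of_ne hne with hlt | hlt
    · exact hsep a ha b hb m n hlt hab.symm
    · exact hsep b hb a ha n m hlt hab

/-! ### Analytic maps and closed subspaces -/

/-- A continuous square root of an analytic function with values in a commutative Banach algebra
is analytic where it is invertible. -/
lemma AnalyticAt.of_sq {E A : Type*} [NormedAddCommGroup E] [NormedSpace ℝ E]
    [NormedCommRing A] [NormedAlgebra ℝ A] [CompleteSpace A] {d : E → A} {y : E}
    (hd : ContinuousAt d y) (hu : IsUnit (d y)) (hsq : AnalyticAt ℝ (fun z => d z ^ 2) y)  :
    AnalyticAt ℝ d y := by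
  obtain ⟨b, hb⟩ := hu.exists_right_inv
  -- The derivative of squaring at d(y) is multiplication by 2 d(y), which is invertible. The local
  -- inverse of squaring then recovers d from d² by continuity.
  let e : A ≃L[ℝ] A := ContinuousLinearEquiv.equivOfInverse
    (ContinuousLinearMap.mul ℝ A ((2 : ℝ) • d y)) (ContinuousLinearMap.mul ℝ A ((2 : ℝ)⁻¹ • b))
    (fun x => by
      simp only [ContinuousLinearMap.mul_apply', smul_mul_assoc, mul_smul_comm, smul_smul]
      rw [← mul_assoc, mul_comm b, hb]; norm_num)
    (fun x => by
      simp only [ContinuousLinearMap.mul_apply', smul_mul_assoc, mul_smul_comm, smul_smul]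
      rw [← mul_assoc, hb]; norm_num)
  have hf : ContDiffAt ℝ ω (fun a : A => a ^ 2) (d y) := contDiffAt_id.pow 2
  have hf' : HasFDerivAt (fun a : A => a ^ 2) (e : A →L[ℝ] A) (d y) := by
    have h1 := (hasFDerivAt_id (𝕜 := ℝ) (d y)).pow 2
    convert! h1 using 1
    ext x
    simp [e, two_smul, add_mul]
  have hω : (ω : ℕ∞ω) ≠ 0 := by simp
  have h1 : ContDiffAt ℝ ω (hf.localInverse hf' hω) (d y ^ 2) := hf.to_localInverse hf' hω
  have h2 : ∀ᶠ a in 𝓝 (d y), hf.localInverse hf' hω (a ^ 2) = a :=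
    (hf.hasStrictFDerivAt' hf' hω).eventually_left_inverse
  have h3 : AnalyticAt ℝ (fun z => hf.localInverse hf' hω (d z ^ 2)) y :=
    AnalyticAt.fun_comp (f := fun z => d z ^ 2) h1.analyticAt hsq
  exact h3.congr (hd.eventually h2)

/-- The identity theorem applied to the composite with the quotient map V → V ⧸ S. -/
lemma AnalyticOnNhd.mem_of_isClosed_submodule {E V : Type*} [NormedAddCommGroup E]
    [NormedSpace ℝ E] [NormedAddCommGroup V] [NormedSpace ℝ V] {S : Submodule ℝ V}
    (hS : IsClosed (S : Set V)) {g : E → V} {D : Set E} (hg : AnalyticOnNhd ℝ g D)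
    (hD : IsPreconnected D) {y₀ : E} (hy₀ : y₀ ∈ D) (h0 : ∀ᶠ z in 𝓝 y₀, g z ∈ S) {y : E}
    (hy : y ∈ D) : g y ∈ S := by
  let π : V →L[ℝ] V ⧸ S := LinearMap.mkContinuous S.mkQ 1 fun m => by
    rw [one_mul]; exact Submodule.Quotient.norm_mk_le S m
  have han : AnalyticOnNhd ℝ (fun y => π (g y)) D := fun y hy =>
    AnalyticAt.fun_comp (g := π) (ContinuousLinearMap.analyticAt π _) (hg y hy)
  have h1 : (fun y => π (g y)) =ᶠ[𝓝 y₀] 0 := by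
    filter_upwards [h0] with z hz
    exact (Submodule.Quotient.mk_eq_zero _).2 hz
  exact (Submodule.Quotient.mk_eq_zero _).1
    (han.eqOn_zero_of_preconnected_of_eventuallyEq_zero hD hy₀ h1 hy)

lemma integral_mem_of_isClosed_submodule {α V : Type*} [MeasurableSpace α] {μ : Measure α}
    [NormedAddCommGroup V] [NormedSpace ℝ V] [CompleteSpace V] {S : Submodule ℝ V}
    (hS : IsClosed (S : Set V)) {g : α → V} (hg : Integrable g μ) (h : ∀ᵐ a ∂μ, g a ∈ S) :
    ∫ a, g a ∂μ ∈ S := by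
  let π : V →L[ℝ] V ⧸ S := LinearMap.mkContinuous S.mkQ 1 fun m => by
    rw [one_mul]; exact Submodule.Quotient.norm_mk_le S m
  rw [← Submodule.Quotient.mk_eq_zero]
  refine Eq.trans (π.integral_comp_comm hg).symm (integral_eq_zero_of_ae ?_)
  filter_upwards [h] with y hy
  exact (Submodule.Quotient.mk_eq_zero _).2 hy

/-! ### Fields with poles as analytic C(K)-valued maps -/

section kernelC
variable {N : ℕ} (K : Set (Euc N))

/-- The distance to `y`, as a continuous function on `K`. -/
noncomputable def distC (y : Euc N) : C(K, ℝ) := ⟨fun x => ‖(x : Euc N) - y‖, by fun_prop⟩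

/-- The `i`-th coordinate of the vector field `x - y`, as a continuous function on `K`. -/
noncomputable def coordC (y : Euc N) (i : Fin N) : C(K, ℝ) :=
  ⟨fun x => (x : Euc N) i - y i, by fun_prop⟩

/-- The vector field `(x - y) / ‖x - y‖ ^ N` on `K`. -/
noncomputable def kernelC (y : Euc N) : Fin N → C(K, ℝ) :=
  fun i => coordC K y i * Ring.inverse (distC K y ^ N)

variable {K}

lemma isUnit_distC {y : Euc N} (hy : y ∉ K) : IsUnit (distC K y) := by
  rw [ContinuousMap.isUnit_iff_forall_ne_zero]
  intro x hx
  have : (x : Euc N) - y = 0 := norm_eq_zero.1 hx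
  exact hy (sub_eq_zero.1 this ▸ x.2)

/-- Off K the distance is a unit of C(K), so `Ring.inverse` is the genuine pointwise inverse and not
its default value 0. -/
lemma kernelC_apply {y : Euc N} (hy : y ∉ K) (i : Fin N) (x : K) :
    kernelC K y i x = ((x : Euc N) i - y i) * (‖(x : Euc N) - y‖ ^ N)⁻¹ := by
  have h := Ring.mul_inverse_cancel _ ((isUnit_distC hy).pow N)
  have h1 := congrArg (fun f : C(K, ℝ) => f x) h
  simp only [ContinuousMap.mul_apply, ContinuousMap.pow_apply, ContinuousMap.one_apply] at h1
  have h2 : (Ring.inverse (distC K y ^ N)) x = (‖(x : Euc N) - y‖ ^ N)⁻¹ :=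
    eq_inv_of_mul_eq_one_right h1
  simp [kernelC, h2, coordC]

variable [CompactSpace K]

lemma continuous_distC : Continuous (distC K) := by
  refine (LipschitzWith.of_dist_le_mul (K := 1) fun y z => ?_).continuous
  rw [ContinuousMap.dist_le (by positivity)]
  intro x
  simp only [distC, ContinuousMap.coe_mk, NNReal.coe_one, one_mul]
  rw [Real.dist_eq]
  refine (abs_norm_sub_norm_le _ _).trans ?_
  rw [dist_eq_norm, ← norm_neg]
  refine le_of_eq (congrArg _ ?_)
  abel

lemma analyticAt_coordC (i : Fin N) (y : Euc N) : AnalyticAt ℝ (fun y => coordC K y i) y := by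
  have h : (fun y : Euc N => coordC K y i) =
      fun y => coordC K 0 i - (y i) • (1 : C(K, ℝ)) := by
    ext y x
    simp [coordC]
  rw [h]
  exact analyticAt_const.sub
    (((EuclideanSpace.proj i : Euc N →L[ℝ] ℝ).analyticAt y).smul analyticAt_const)

/-- The squared distance is polynomial in y. The distance is its continuous square root, invertible
when y is off K. -/
lemma analyticAt_distC {y : Euc N} (hy : y ∉ K) : AnalyticAt ℝ (distC K) y := by
  refine AnalyticAt.of_sq continuous_distC.continuousAt (isUnit_distC hy) ?_
  have h : (fun y : Euc N => distC K y ^ 2) = fun y => ∑ i, coordC K y i ^ 2 := by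
    ext y x
    simp [distC, coordC, EuclideanSpace.real_norm_sq_eq]
  rw [h]
  exact Finset.analyticAt_fun_sum _ fun i _ => (analyticAt_coordC i y).pow 2

lemma analyticAt_kernelC {y : Euc N} (hy : y ∉ K) : AnalyticAt ℝ (kernelC K) y := by
  rw [analyticAt_pi_iff]
  intro i
  refine (analyticAt_coordC i y).mul ?_
  have h1 := analyticAt_inverse (𝕜 := ℝ) ((isUnit_distC hy).pow N).unit
  exact AnalyticAt.fun_comp (g := Ring.inverse) (f := fun z => distC K z ^ N) h1
    ((analyticAt_distC hy).pow N)

variable (K)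

/-- The closed span of the fields `(x - y) / ‖x - y‖ ^ N` on `K` with poles `y ∉ F`. -/
noncomputable def poleSpan (F : Set (Euc N)) : Submodule ℝ (Fin N → C(K, ℝ)) :=
  (Submodule.span ℝ (kernelC K '' Fᶜ)).topologicalClosure

variable {K}

lemma isClosed_poleSpan (F : Set (Euc N)) : IsClosed (poleSpan K F : Set (Fin N → C(K, ℝ))) :=
  Submodule.isClosed_topologicalClosure _

lemma kernelC_mem_poleSpan {F : Set (Euc N)} {y : Euc N} (hy : y ∉ F) :
    kernelC K y ∈ poleSpan K F :=
  Submodule.le_topologicalClosure _ (Submodule.subset_span ⟨y, hy, rfl⟩)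

/-- Pole pushing. -/
lemma kernelC_mem_poleSpan_of_preconnected {F D : Set (Euc N)} (hF : IsClosed F)
    (hD : IsPreconnected D) (hDK : Disjoint D K) (hDF : (D ∩ Fᶜ).Nonempty) {y : Euc N}
    (hy : y ∈ D) : kernelC K y ∈ poleSpan K F := by
  obtain ⟨y₀, hy₀D, hy₀F⟩ := hDF
  refine AnalyticOnNhd.mem_of_isClosed_submodule (isClosed_poleSpan F)
    (fun y hy => analyticAt_kernelC (disjoint_left.1 hDK hy)) hD hy₀D ?_ hy
  filter_upwards [hF.isOpen_compl.mem_nhds hy₀F] with z hz using kernelC_mem_poleSpan hz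

end kernelC

/-! ### Test gradients as limits of fields with exterior poles -/

section IsPoleLimit
variable {N : ℕ} {K F : Set (Euc N)} [CompactSpace K]

variable (K F) in
/-- The vector field `g` on `K` is a uniform limit of linear combinations of the fields
`(x - y) / ‖x - y‖ ^ N` with poles `y ∉ F`. -/
def IsPoleLimit (g : Euc N → Fin N → ℝ) : Prop :=
  ∃ s ∈ poleSpan K F, ∀ i (x : K), s i x = g x i

lemma IsPoleLimit.congr {g g' : Euc N → Fin N → ℝ} (h : IsPoleLimit K F g)
    (hg : ∀ x ∈ K, ∀ i, g x i = g' x i) : IsPoleLimit K F g' := by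
  obtain ⟨s, hs, h⟩ := h
  exact ⟨s, hs, fun i x => (h i x).trans (hg x x.2 i)⟩

lemma IsPoleLimit.add {g g' : Euc N → Fin N → ℝ} (h : IsPoleLimit K F g)
    (h' : IsPoleLimit K F g') : IsPoleLimit K F (fun x i => g x i + g' x i) := by
  obtain ⟨s, hs, h⟩ := h
  obtain ⟨s', hs', h'⟩ := h'
  exact ⟨s + s', add_mem hs hs', fun i x => by simp [h, h']⟩

lemma IsPoleLimit.of_approx {g : Euc N → Fin N → ℝ} (hg : ∀ i, ContinuousOn (fun x => g x i) K)
    (h : ∀ ε > 0, ∃ g', IsPoleLimit K F g' ∧ ∀ x ∈ K, ∀ i, |g x i - g' x i| ≤ ε) :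
    IsPoleLimit K F g := by
  refine ⟨fun i => ⟨K.domRestrict fun x => g x i, (hg i).domRestrict⟩, ?_, fun i x => rfl⟩
  rw [← SetLike.mem_coe, ← (isClosed_poleSpan F).closure_eq, Metric.mem_closure_iff]
  intro ε hε
  obtain ⟨g', ⟨s, hs, hsg⟩, hgg'⟩ := h (ε / 2) (by positivity)
  refine ⟨s, hs, lt_of_le_of_lt ?_ (half_lt_self hε)⟩
  rw [dist_pi_le_iff (by positivity)]
  intro i
  rw [ContinuousMap.dist_le (by positivity)]
  intro x
  rw [Real.dist_eq, hsg]
  exact hgg' x x.2 i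

/-- Thin neighbourhoods of the null compact set K have small measure, and y ↦ x - y preserves
measure. Absolute continuity of the integral of one fixed kernel therefore gives a bound uniform in
x. -/
lemma exists_thickening_integral_kernel_le (hN : 2 ≤ N) (hK : volume K = 0) (R : ℝ) {ε : ℝ}
    (hε : 0 < ε) : ∃ δ > 0, ∀ x, ∫ y in Metric.thickening δ K,
      (Metric.ball (0 : Euc N) R).indicator (fun z => ‖z‖ * (‖z‖ ^ N)⁻¹) (x - y) ≤ ε := by
  set h : Euc N → ℝ := (Metric.ball (0 : Euc N) R).indicator (fun z => ‖z‖ * (‖z‖ ^ N)⁻¹) with hh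
  have hint : Integrable h :=
    (integrable_indicator_iff Metric.isOpen_ball.measurableSet).2
      (norm_mul_inv_norm_pow_integrableOn hN R)
  have hKc : IsCompact K := isCompact_iff_compactSpace.2 inferInstance
  have h1 : Tendsto (fun s : Set (Euc N) => ∫ z in s, h z) (comap volume (𝓝 0)) (𝓝 0) :=
    hint.tendsto_setIntegral_nhds_zero tendsto_comap
  have h2 := h1.eventually_le_const hε
  rw [eventually_comap] at h2
  have h3 : Tendsto (fun r => volume (Metric.thickening r K)) (𝓝[>] 0) (𝓝 0) := by
    rw [← hK]
    exact tendsto_measure_thickening_of_isClosed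
      ⟨1, one_pos, (hKc.isBounded.thickening).measure_lt_top.ne⟩ hKc.isClosed
  obtain ⟨δ, hδ, hδ0⟩ := ((h3.eventually h2).and self_mem_nhdsWithin).exists
  refine ⟨δ, hδ0, fun x => ?_⟩
  have hmp : MeasurePreserving (fun y : Euc N => x - y) volume volume :=
    Measure.measurePreserving_sub_left volume x
  have hemb : MeasurableEmbedding (fun y : Euc N => x - y) :=
    (Homeomorph.subLeft x).measurableEmbedding
  have h4 := hmp.setIntegral_preimage_emb hemb h ((fun y => x - y) ⁻¹' Metric.thickening δ K)
  have h5 : (fun y : Euc N => x - y) ⁻¹' ((fun y => x - y) ⁻¹' Metric.thickening δ K) =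
      Metric.thickening δ K := by
    ext y; simp
  rw [h5] at h4
  rw [h4]
  refine hδ _ ?_
  exact hmp.measure_preimage Metric.isOpen_thickening.measurableSet.nullMeasurableSet

/-- On a null compact set, gradients of test functions are limits of fields with poles. -/
lemma isPoleLimit_fderiv (hN : 2 ≤ N) (hK : volume K = 0)
    (hpole : ∀ᵐ y, kernelC K y ∈ poleSpan K F) {φ : Euc N → ℝ} (hφ : ContDiff ℝ 2 φ)
    (hφc : HasCompactSupport φ) : IsPoleLimit K F (fun x i => fderiv ℝ φ x (stdVec i)) := by
  have hKc : IsCompact K := isCompact_iff_compactSpace.2 inferInstance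
  have hC := kernelMass_pos hN
  refine IsPoleLimit.of_approx (fun i => ((hφ.continuous_fderiv (by norm_num)).clm_apply
    continuous_const).continuousOn) fun ε hε => ?_
  have hLc := continuous_laplacian hφ
  obtain ⟨M, hM⟩ := hφc.laplacian.exists_bound_of_continuous hLc
  have hM0 : 0 ≤ M := (norm_nonneg _).trans (hM 0)
  obtain ⟨R, hR⟩ := (hKc.isBounded.union hφc.laplacian.isBounded).subset_ball (0 : Euc N)
  obtain ⟨δ, hδ, hsmall⟩ := exists_thickening_integral_kernel_le (K := K) hN hK (2 * R)
    (ε := kernelMass N * ε / (M + 1)) (by positivity)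
  set h : Euc N → ℝ := (Metric.ball (0 : Euc N) (2 * R)).indicator
    (fun z => ‖z‖ * (‖z‖ ^ N)⁻¹) with hh
  have hint : Integrable h :=
    (integrable_indicator_iff Metric.isOpen_ball.measurableSet).2
      (norm_mul_inv_norm_pow_integrableOn hN _)
  set W := Metric.thickening δ K with hW
  -- Poles are kept at distance at least δ from K. On this compact set the C(K)-valued field is
  -- continuous, so its integral stays in the closed span, and the discarded part is the error.
  set A : Set (Euc N) := Wᶜ ∩ Metric.closedBall 0 R with hA
  have hAc : IsCompact A :=
    (isCompact_closedBall 0 R).inter_left Metric.isOpen_thickening.isClosed_compl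
  have hAK : ∀ y ∈ A, y ∉ K := fun y hy hyK => hy.1 (Metric.self_subset_thickening hδ K hyK)
  have hGint : IntegrableOn (fun y => Laplacian.laplacian φ y • kernelC K y) A :=
    ContinuousOn.integrableOn_compact hAc (hLc.continuousOn.smul fun y hy =>
      (analyticAt_kernelC (hAK y hy)).continuousAt.continuousWithinAt)
  have hmem : ∫ y in A, Laplacian.laplacian φ y • kernelC K y ∈ poleSpan K F :=
    integral_mem_of_isClosed_submodule (isClosed_poleSpan F) hGint <| by
      filter_upwards [ae_restrict_of_ae hpole] with y hy using Submodule.smul_mem _ _ hy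
  refine ⟨fun x i => (kernelMass N)⁻¹ * ∫ y in A, Laplacian.laplacian φ y *
    ((x i - y i) * (‖x - y‖ ^ N)⁻¹), ⟨(kernelMass N)⁻¹ • ∫ y in A, Laplacian.laplacian φ y •
      kernelC K y, Submodule.smul_mem _ _ hmem, fun i x => ?_⟩, fun x hx i => ?_⟩
  · let ev : (Fin N → C(K, ℝ)) →L[ℝ] ℝ :=
      (ContinuousMap.evalCLM ℝ x).comp (ContinuousLinearMap.proj i)
    have h1 := ev.integral_comp_comm hGint
    rw [Pi.smul_apply, ContinuousMap.smul_apply, smul_eq_mul]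
    congr 1
    refine Eq.trans h1.symm (setIntegral_congr_fun hAc.measurableSet fun y hy => ?_)
    simp [ev, kernelC_apply (hAK y hy)]
  · set f : Euc N → ℝ := fun y => Laplacian.laplacian φ y *
      ((x i - y i) * (‖x - y‖ ^ N)⁻¹) with hf
    have hbound : ∀ y, ‖f y‖ ≤ M * h (x - y) := by
      intro y
      by_cases hy : Laplacian.laplacian φ y = 0
      · simp only [hf, hy, zero_mul, norm_zero]
        refine mul_nonneg hM0 (indicator_nonneg (fun z _ => by positivity) _)
      · have hyR : ‖y‖ < R := by
          simpa using hR (Or.inr (subset_tsupport _ hy))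
        have hxR : ‖x‖ < R := by simpa using hR (Or.inl hx)
        have hxy : x - y ∈ Metric.ball (0 : Euc N) (2 * R) := by
          rw [mem_ball_zero_iff]
          linarith [norm_sub_le x y]
        rw [hh, indicator_of_mem hxy, hf, norm_mul, norm_mul, Real.norm_eq_abs (x i - y i)]
        have h1 := abs_coord_le_norm (x - y) i
        rw [PiLp.sub_apply] at h1
        rw [Real.norm_of_nonneg (by positivity : 0 ≤ (‖x - y‖ ^ N)⁻¹)]
        gcongr
        exact hM y
    have hHint : Integrable (fun y => M * h (x - y)) := (hint.comp_sub_left x).const_mul M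
    have hci : ∀ i : Fin N, Measurable fun z : Euc N => z i := fun i =>
      (EuclideanSpace.proj i : Euc N →L[ℝ] ℝ).continuous.measurable
    have hfint : Integrable f := by
      refine hHint.mono' (Measurable.aestronglyMeasurable ?_) (ae_of_all _ hbound)
      exact hLc.measurable.mul ((measurable_const.sub (hci i)).mul
        (((measurable_const.sub measurable_id).norm.pow_const N).inv))
    have hrep := fderiv_eq_integral_kernel hN hφ hφc x i
    rw [← integral_add_compl hAc.measurableSet hfint] at hrep
    have herr : ‖∫ y in Aᶜ, f y‖ ≤ kernelMass N * ε := by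
      rw [← integral_indicator hAc.measurableSet.compl]
      calc _ ≤ ∫ y, W.indicator (fun y => M * h (x - y)) y := by
            refine norm_integral_le_of_norm_le
              (hHint.indicator Metric.isOpen_thickening.measurableSet) (ae_of_all _ fun y => ?_)
            by_cases hyW : y ∈ W
            · rw [indicator_of_mem hyW]
              exact (norm_indicator_le_norm_self _ _).trans (hbound y)
            · rw [indicator_of_notMem hyW]
              by_cases hyA : y ∈ A
              · rw [indicator_of_notMem (by simpa using hyA), norm_zero]
              · have hy0 : Laplacian.laplacian φ y = 0 := by
                  by_contra hy
                  have : ‖y‖ < R := by simpa using hR (Or.inr (subset_tsupport _ hy))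
                  exact hyA ⟨hyW, by simpa using this.le⟩
                rw [indicator_of_mem (by simpa using hyA)]
                simp [hf, hy0]
        _ = M * ∫ y in W, h (x - y) := by
            rw [integral_indicator Metric.isOpen_thickening.measurableSet, integral_const_mul]
        _ ≤ M * (kernelMass N * ε / (M + 1)) := by gcongr; exact hsmall x
        _ ≤ kernelMass N * ε := by
            rw [mul_div_assoc', div_le_iff₀ (by positivity)]
            nlinarith [mul_pos hC hε]
    have : fderiv ℝ φ x (stdVec i) - (kernelMass N)⁻¹ * ∫ y in A, f y =
        (kernelMass N)⁻¹ * ∫ y in Aᶜ, f y := by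
      field_simp
      linarith
    rw [this, abs_mul, abs_of_pos (inv_pos.2 hC), inv_mul_le_iff₀ hC]
    exact herr

end IsPoleLimit

/-! ### The gradient on the closure, and smooth cutoffs -/

section gradClosure
variable {N : ℕ} {Ω : Set (Euc N)} {u : Euc N → ℝ}

lemma IsC1Closure.continuousAt_gradient (hu : IsC1Closure Ω u) (hΩ : IsOpen Ω) {x : Euc N}
    (hx : x ∈ Ω) : ContinuousAt (fun z => ∇ u z) x := by
  have h1 := (hu.contDiffOn.continuousOn_fderiv_of_isOpen hΩ (by simp)).continuousAt
    (hΩ.mem_nhds hx)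
  exact (InnerProductSpace.toDual ℝ (Euc N)).symm.continuous.continuousAt.comp h1

lemma IsC1Closure.continuousOn_gradClosure (hu : IsC1Closure Ω u) (hΩ : IsOpen Ω) :
    ContinuousOn (gradClosure Ω u) (closure Ω) := by
  refine continuousOn_extendFrom subset_rfl fun x hx => ?_
  by_cases h : x ∈ Ω
  · exact ⟨_, (hu.continuousAt_gradient hΩ h).tendsto.mono_left nhdsWithin_le_nhds⟩
  · exact hu.tendsto_gradient x (by rw [hΩ.frontier_eq]; exact ⟨hx, h⟩)

lemma IsC1Closure.gradClosure_eq (hu : IsC1Closure Ω u) (hΩ : IsOpen Ω) {x : Euc N}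
    (hx : x ∈ Ω) : gradClosure Ω u x = ∇ u x :=
  extendFrom_eq (subset_closure hx)
    ((hu.continuousAt_gradient hΩ hx).tendsto.mono_left nhdsWithin_le_nhds)

end gradClosure

lemma IsCompact.exists_smooth_cutoff {N : ℕ} {K O : Set (Euc N)} (hK : IsCompact K) (hO : IsOpen O)
    (hKO : K ⊆ O) : ∃ θ : Euc N → ℝ, ContDiff ℝ ∞ θ ∧ HasCompactSupport θ ∧ tsupport θ ⊆ O ∧
      ∀ x ∈ K, ∀ᶠ y in 𝓝 x, θ y = 1 := by
  obtain ⟨L, hL, hKL, hLO⟩ := exists_compact_between hK hO hKO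
  obtain ⟨f, hf1, hf0, -⟩ := exists_contMDiffMap_one_nhds_of_subset_interior
    (modelWithCornersSelf ℝ (Euc N)) (n := ⊤) hK.isClosed hKL
  have hsupp : tsupport f ⊆ L := closure_minimal (fun x hx => by
    by_contra h
    exact hx (hf0 x h)) hL.isClosed
  exact ⟨f, f.contMDiff.contDiff, hL.of_isClosed_subset (isClosed_tsupport _) hsupp,
    hsupp.trans hLO, fun x hx => eventually_nhdsSet_iff_forall.1 hf1 x hx⟩

/-! ### Gradients of C¹(Ω̄) functions as limits -/

section cutoffField
variable {N : ℕ} {Ω K F : Set (Euc N)} {u : Euc N → ℝ}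

/-- The field which is formally the gradient of `χ u` on the closure of `Ω`. -/
noncomputable def cutoffField (Ω : Set (Euc N)) (u χ : Euc N → ℝ) (x : Euc N) (i : Fin N) : ℝ :=
  fderiv ℝ χ x (stdVec i) * u x + χ x * gradClosure Ω u x i

lemma cutoffField_add {χ ψ : Euc N → ℝ} (hχ : ContDiff ℝ ∞ χ) (hψ : ContDiff ℝ ∞ ψ) (x : Euc N)
    (i : Fin N) : cutoffField Ω u (fun y => χ y + ψ y) x i =
      cutoffField Ω u χ x i + cutoffField Ω u ψ x i := by
  have h := fderiv_fun_add (hχ.differentiable (by simp) x) (hψ.differentiable (by simp) x)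
  simp only [cutoffField, h, add_apply]
  ring

lemma cutoffField_congr {χ ψ : Euc N → ℝ} {x : Euc N} (h : χ =ᶠ[𝓝 x] ψ) (i : Fin N) :
    cutoffField Ω u χ x i = cutoffField Ω u ψ x i := by
  simp only [cutoffField, h.fderiv_eq, h.self_of_nhds]

lemma continuousOn_cutoffField (hΩ : IsOpen Ω) (hu : IsC1Closure Ω u) {χ : Euc N → ℝ}
    (hχ : ContDiff ℝ ∞ χ) (i : Fin N) :
    ContinuousOn (fun x => cutoffField Ω u χ x i) (closure Ω) := by
  have h1 : Continuous fun x => fderiv ℝ χ x (stdVec i) :=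
    (hχ.continuous_fderiv (by simp)).clm_apply continuous_const
  exact (h1.continuousOn.mul hu.continuousOn).add (hχ.continuous.continuousOn.mul
    ((EuclideanSpace.proj i : Euc N →L[ℝ] ℝ).continuous.comp_continuousOn
      (hu.continuousOn_gradClosure hΩ)))

variable [CompactSpace K]

variable (Ω K F u) in
/-- All fields `∇(χ u)` with cutoff functions `χ` supported in `O` are limits of fields with poles
off `F`. -/
def CutoffApprox (O : Set (Euc N)) : Prop :=
  ∀ χ : Euc N → ℝ, ContDiff ℝ ∞ χ → HasCompactSupport χ → tsupport χ ⊆ O →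
    IsPoleLimit K F (cutoffField Ω u χ)

/-- Split χ = θ χ + (1 - θ) χ, with θ supported in O₁ and equal to 1 near the part of the support of
χ outside O₂. -/
lemma CutoffApprox.union {O₁ O₂ : Set (Euc N)} (ho₁ : IsOpen O₁) (ho₂ : IsOpen O₂)
    (h₁ : CutoffApprox Ω K F u O₁) (h₂ : CutoffApprox Ω K F u O₂) :
    CutoffApprox Ω K F u (O₁ ∪ O₂) := by
  intro χ hχ hχc hsupp
  obtain ⟨θ, hθ, hθc, hθO, hθ1⟩ := (hχc.isCompact.diff ho₂).exists_smooth_cutoff ho₁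
    (fun x hx => (hsupp hx.1).resolve_right hx.2)
  have a1 := h₁ (fun x => θ x * χ x) (hθ.mul hχ) hθc.mul_right
    ((tsupport_mul_subset_left).trans hθO)
  have a2 := h₂ (fun x => (1 - θ x) * χ x) ((contDiff_const.sub hθ).mul hχ) hχc.mul_left ?_
  · refine (a1.add a2).congr fun x _ i => ?_
    rw [← cutoffField_add (hθ.mul hχ) ((contDiff_const.sub hθ).mul hχ)]
    congr 1
    ext y
    ring
  · intro x hx
    by_contra hxO
    have hxχ : x ∈ tsupport χ := tsupport_mul_subset_right hx
    have h3 := hθ1 x ⟨hxχ, hxO⟩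
    refine absurd hx (notMem_tsupport_iff_eventuallyEq.2 ?_)
    filter_upwards [h3] with y hy
    simp [hy]

lemma cutoffApprox_empty : CutoffApprox Ω K F u ∅ := by
  intro χ _ _ hsupp
  have h : χ = 0 := tsupport_eq_empty_iff.1 (subset_empty_iff.1 hsupp)
  exact ⟨0, zero_mem _, fun i x => by simp [h, cutoffField]⟩

/-- The translate u(· + t v) is C² near K ∩ supp χ because v points into Ω. Multiplied by χ and a
further cutoff it is a test function, and uniform continuity of u and its gradient controls the
error as t → 0. -/
lemma cutoffApprox_ball (hΩ : IsOpen Ω) (hbdd : Bornology.IsBounded Ω) (hu : IsC1Closure Ω u)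
    (hu2 : ContDiffOn ℝ 2 u Ω) (hKΩ : K ⊆ closure Ω)
    (htest : ∀ φ : Euc N → ℝ, ContDiff ℝ 2 φ → HasCompactSupport φ →
      IsPoleLimit K F (fun x i => fderiv ℝ φ x (stdVec i)))
    {p v : Euc N} {r : ℝ} (hr : 0 < r)
    (hv : ∀ x ∈ Metric.ball p r, ∀ t : ℝ, 0 < t → t < r → x ∈ closure Ω → x + t • v ∈ Ω) :
    CutoffApprox Ω K F u (Metric.ball p r) := by
  intro χ hχ hχc hsupp
  have hKc : IsCompact K := isCompact_iff_compactSpace.2 inferInstance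
  have hcc : IsCompact (closure Ω) := hbdd.isCompact_closure
  refine IsPoleLimit.of_approx (fun i => (continuousOn_cutoffField hΩ hu hχ i).mono hKΩ)
    fun ε hε => ?_
  obtain ⟨A, hA⟩ := (hχc.fderiv ℝ).exists_bound_of_continuous (hχ.continuous_fderiv (by simp))
  obtain ⟨B, hB⟩ := hχc.exists_bound_of_continuous hχ.continuous
  have hA0 : 0 ≤ A := (norm_nonneg _).trans (hA 0)
  have hB0 : 0 ≤ B := (norm_nonneg _).trans (hB 0)
  -- A bounds the derivative of χ and B bounds χ, so the two errors add up to at most (A + B) η.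
  set η := ε / (A + B + 1) with hη
  have hη0 : 0 < η := by positivity
  have huc := hcc.uniformContinuousOn_of_continuous hu.continuousOn
  have hgc := hcc.uniformContinuousOn_of_continuous (hu.continuousOn_gradClosure hΩ)
  obtain ⟨δ₁, hδ₁, h₁⟩ := Metric.uniformContinuousOn_iff.1 huc η hη0
  obtain ⟨δ₂, hδ₂, h₂⟩ := Metric.uniformContinuousOn_iff.1 hgc η hη0
  obtain ⟨t, ht0, htr, ht1, ht2⟩ : ∃ t : ℝ, 0 < t ∧ t < r ∧ t * ‖v‖ < δ₁ ∧ t * ‖v‖ < δ₂ := by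
    have hlim : Tendsto (fun t : ℝ => t * ‖v‖) (𝓝[>] 0) (𝓝 0) := by
      have : Continuous fun t : ℝ => t * ‖v‖ := by fun_prop
      simpa using (this.tendsto 0).mono_left nhdsWithin_le_nhds
    have hlt : ∀ᶠ t : ℝ in 𝓝[>] 0, t < r :=
      (eventually_lt_nhds hr).filter_mono nhdsWithin_le_nhds
    obtain ⟨t, h⟩ := ((eventually_mem_nhdsWithin (a := (0 : ℝ)) (s := Ioi 0)).and (hlt.and
      ((hlim.eventually_lt_const hδ₁).and (hlim.eventually_lt_const hδ₂)))).exists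
    exact ⟨t, h.1, h.2.1, h.2.2.1, h.2.2.2⟩
  let f : Euc N → ℝ := fun x => u (x + t • v)
  let O : Set (Euc N) := (fun x => x + t • v) ⁻¹' Ω
  have hO : IsOpen O := hΩ.preimage (by fun_prop)
  have hfO : ContDiffOn ℝ 2 f O := hu2.comp (by fun_prop) fun x hx => hx
  have hKO : K ∩ tsupport χ ⊆ O := fun x hx => hv x (hsupp hx.2) t ht0 htr (hKΩ hx.1)
  obtain ⟨θ, hθ, hθc, hθO, hθ1⟩ :=
    (hKc.inter_right (isClosed_tsupport χ)).exists_smooth_cutoff hO hKO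
  let φ : Euc N → ℝ := fun x => θ x * χ x * f x
  have hφ : ContDiff ℝ 2 φ := hfO.contDiff_mul_of_tsupport_subset hO
    (contDiff_infty.1 (hθ.mul hχ) 2) (tsupport_mul_subset_left.trans hθO)
  refine ⟨_, htest φ hφ (hθc.mul_right.mul_right), fun x hx i => ?_⟩
  by_cases hxχ : x ∈ tsupport χ
  · have hxO := hKO ⟨hx, hxχ⟩
    have hfx : HasFDerivAt f (fderiv ℝ u (x + t • v)) x :=
      (hasFDerivAt_comp_add_right (t • v)).2
        ((hu2.contDiffAt (hΩ.mem_nhds hxO)).differentiableAt (by norm_num)).hasFDerivAt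
    have hφx : φ =ᶠ[𝓝 x] χ * f := by
      filter_upwards [hθ1 x ⟨hx, hxχ⟩] with y hy
      simp [φ, hy]
    have hder : fderiv ℝ φ x (stdVec i) =
        fderiv ℝ χ x (stdVec i) * u (x + t • v) + χ x * gradClosure Ω u (x + t • v) i := by
      rw [hφx.fderiv_eq, ((hχ.differentiable (by simp) x).hasFDerivAt.mul hfx).fderiv,
        hu.gradClosure_eq hΩ hxO, gradient_apply_eq]
      simp [f]
      ring
    have hdist : dist x (x + t • v) = t * ‖v‖ := by
      rw [dist_self_add_right, norm_smul, Real.norm_of_nonneg ht0.le]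
    have e1 := h₁ x (hKΩ hx) _ (subset_closure hxO) (by rwa [hdist])
    have e2 := h₂ x (hKΩ hx) _ (subset_closure hxO) (by rwa [hdist])
    rw [Real.dist_eq] at e1
    rw [dist_eq_norm] at e2
    have e3 := abs_coord_le_norm (gradClosure Ω u x - gradClosure Ω u (x + t • v)) i
    rw [PiLp.sub_apply] at e3
    have e4 : |fderiv ℝ χ x (stdVec i)| ≤ A := by
      refine ((fderiv ℝ χ x).le_opNorm (stdVec i)).trans ?_
      simpa using hA x
    have e5 : |χ x| ≤ B := hB x
    have e6 : cutoffField Ω u χ x i - fderiv ℝ φ x (stdVec i) =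
        fderiv ℝ χ x (stdVec i) * (u x - u (x + t • v)) +
          χ x * (gradClosure Ω u x i - gradClosure Ω u (x + t • v) i) := by
      rw [hder, cutoffField]; ring
    rw [e6]
    calc _ ≤ |fderiv ℝ χ x (stdVec i)| * |u x - u (x + t • v)| +
          |χ x| * |gradClosure Ω u x i - gradClosure Ω u (x + t • v) i| := by
          rw [← abs_mul, ← abs_mul]; exact abs_add_le _ _
      _ ≤ A * η + B * η := by
          gcongr
          exact e3.trans e2.le
      _ ≤ (A + B + 1) * η := by nlinarith
      _ = ε := by rw [hη]; field_simp
  · have h0 : χ =ᶠ[𝓝 x] fun _ => 0 := notMem_tsupport_iff_eventuallyEq.1 hxχ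
    have hφ0 : φ =ᶠ[𝓝 x] fun _ => 0 := by
      filter_upwards [h0] with y hy
      simp [φ, hy]
    rw [cutoffField_congr h0, hφ0.fderiv_eq]
    simp [cutoffField, hε.le]

/-- The gradient of `u ∈ C¹(Ω̄)` on a compact part `K` of the boundary is a limit of fields with
poles off `F`, provided that all gradients of test functions are. -/
lemma isPoleLimit_gradClosure (hΩ : IsSmoothBoundedDomain Ω) (hu : IsC1Closure Ω u)
    (hu2 : ContDiffOn ℝ 2 u Ω) (hKΩ : K ⊆ frontier Ω)
    (htest : ∀ φ : Euc N → ℝ, ContDiff ℝ 2 φ → HasCompactSupport φ →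
      IsPoleLimit K F (fun x i => fderiv ℝ φ x (stdVec i))) :
    IsPoleLimit K F (fun x i => gradClosure Ω u x i) := by
  have hKc : IsCompact K := isCompact_iff_compactSpace.2 inferInstance
  obtain ⟨O, hO, hKO, happ⟩ : ∃ O, IsOpen O ∧ K ⊆ O ∧ CutoffApprox Ω K F u O := by
    refine hKc.induction_on (p := fun s => ∃ O, IsOpen O ∧ s ⊆ O ∧ CutoffApprox Ω K F u O)
      ⟨∅, isOpen_empty, subset_rfl, cutoffApprox_empty⟩
      (fun s t hst ⟨O, hO, htO, h⟩ => ⟨O, hO, hst.trans htO, h⟩)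
      (fun s t ⟨O, hO, hsO, h⟩ ⟨O', hO', htO', h'⟩ =>
        ⟨O ∪ O', hO.union hO', union_subset_union hsO htO', h.union hO hO' h'⟩) fun p hp => ?_
    obtain ⟨v, r, hr, hv⟩ := hΩ.exists_transversal (hKΩ hp)
    exact ⟨Metric.ball p r, mem_nhdsWithin_of_mem_nhds (Metric.ball_mem_nhds p hr),
      Metric.ball p r, Metric.isOpen_ball, subset_rfl,
      cutoffApprox_ball hΩ.isOpen hΩ.isBounded hu hu2 (hKΩ.trans frontier_subset_closure) htest hr
        fun x hx t ht htr => (hv x hx t ht htr).1⟩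
  obtain ⟨θ, hθ, hθc, hθO, hθ1⟩ := hKc.exists_smooth_cutoff hO hKO
  refine (happ θ hθ hθc hθO).congr fun x hx i => ?_
  rw [cutoffField_congr (hθ1 x hx)]
  simp [cutoffField]

end cutoffField

/-! ### Fundamental solution and harmonic potentials -/

section pole
variable {N : ℕ}

lemma hasFDerivAt_inv_norm_pow {z : Euc N} (hz : z ≠ 0) (n : ℕ) :
    HasFDerivAt (fun z : Euc N => (‖z‖ ^ n)⁻¹)
      ((-(n : ℝ) * (‖z‖ ^ (n + 2))⁻¹) • innerSL ℝ z) z := by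
  have h0 : (regNorm 0 : Euc N → ℝ) = fun z => ‖z‖ := by
    ext z; simp [regNorm]
  have h := hasFDerivAt_inv_regNorm_pow (δ := 0) (z := z) (by simpa [h0] using hz) n
  simpa only [h0] using h

/-- The fundamental solution of the Laplacian, up to constants: a potential of `z / ‖z‖ ^ N`. -/
noncomputable def poleFun (N : ℕ) (z : Euc N) : ℝ :=
  ∫ s in (1 : ℝ)..‖z‖, s * (s ^ N)⁻¹

lemma hasFDerivAt_poleFun {z : Euc N} (hz : z ≠ 0) :
    HasFDerivAt (poleFun N) ((‖z‖ ^ N)⁻¹ • innerSL ℝ z) z := by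
  have hpos : 0 < ‖z‖ := norm_pos_iff.2 hz
  have hc : ContinuousOn (fun s : ℝ => s * (s ^ N)⁻¹) (Ioi 0) :=
    continuousOn_id.mul ((continuousOn_id.pow N).inv₀ fun s hs => (pow_pos hs N).ne')
  have h1 : HasDerivAt (fun r : ℝ => ∫ s in (1 : ℝ)..r, s * (s ^ N)⁻¹)
      (‖z‖ * (‖z‖ ^ N)⁻¹) ‖z‖ := by
    refine intervalIntegral.integral_hasDerivAt_right ?_ ?_
      (hc.continuousAt (isOpen_Ioi.mem_nhds hpos))
    · refine (hc.mono fun s hs => ?_).intervalIntegrable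
      exact (lt_min one_pos hpos).trans_le hs.1
    · exact hc.stronglyMeasurableAtFilter isOpen_Ioi _ hpos
  have h2 := hasFDerivAt_regNorm (δ := 0) (z := z) (by simpa [regNorm] using hz)
  have h0 : (regNorm 0 : Euc N → ℝ) = fun z => ‖z‖ := by
    ext z; simp [regNorm]
  rw [h0] at h2
  have h3 := h1.comp_hasFDerivAt z h2
  convert! h3 using 1
  rw [smul_smul]
  congr 1
  field_simp

lemma contDiffOn_poleFun : ContDiffOn ℝ 2 (poleFun N) {0}ᶜ := by
  rw [show (2 : ℕ∞ω) = 1 + 1 by norm_num, contDiffOn_succ_iff_fderiv_of_isOpen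
    isOpen_compl_singleton]
  refine ⟨fun z hz => (hasFDerivAt_poleFun hz).differentiableAt.differentiableWithinAt, by simp,
    ?_⟩
  have h : ContDiffOn ℝ 1 (fun z : Euc N => (‖z‖ ^ N)⁻¹ • innerSL ℝ z) {0}ᶜ := fun z hz =>
    ((((contDiffAt_norm ℝ hz).pow N).inv (pow_ne_zero _ (norm_ne_zero_iff.2 hz))).smul
      (innerSL ℝ).contDiff.contDiffAt).contDiffWithinAt
  exact h.congr fun z hz => (hasFDerivAt_poleFun hz).fderiv

/-- The trace of the Hessian is -N ‖z‖ ^ (-N - 2) ‖z‖² + N ‖z‖ ^ (-N) = 0. -/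
lemma laplacian_poleFun {z : Euc N} (hz : z ≠ 0) : Laplacian.laplacian (poleFun N) z = 0 := by
  have hC : ContDiffAt ℝ 2 (poleFun N) z :=
    contDiffOn_poleFun.contDiffAt (isOpen_compl_singleton.mem_nhds hz)
  have h1 : ∀ i : Fin N, fderiv ℝ (fderiv ℝ (poleFun N)) z (stdVec i) (stdVec i) =
      -(N : ℝ) * (‖z‖ ^ (N + 2))⁻¹ * z i * z i + (‖z‖ ^ N)⁻¹ := by
    intro i
    rw [← fderiv_fderiv_apply hC]
    have h2 : (fun y => fderiv ℝ (poleFun N) y (stdVec i)) =ᶠ[𝓝 z]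
        fun y => (‖y‖ ^ N)⁻¹ * y i := by
      filter_upwards [isOpen_compl_singleton.mem_nhds hz] with y hy
      rw [(hasFDerivAt_poleFun hy).fderiv]
      simp [EuclideanSpace.inner_single_right]
    rw [h2.fderiv_eq, fderiv_mul_coord (m := -(N : ℝ) * (‖z‖ ^ (N + 2))⁻¹)
      (hasFDerivAt_inv_norm_pow hz N).differentiableAt (fun w => by
        rw [(hasFDerivAt_inv_norm_pow hz N).fderiv]; simp)]
    simp
  rw [laplacian_eq_sum_fderiv]
  simp only [h1, Finset.sum_add_distrib, mul_assoc]
  rw [← Finset.mul_sum, ← Finset.mul_sum]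
  have h3 := EuclideanSpace.real_norm_sq_eq z
  simp only [pow_two (z _)] at h3
  rw [← h3]
  have := norm_pos_iff.2 hz
  simp
  field_simp
  ring

/-- Linear combinations of fields with poles are gradients of harmonic functions. -/
lemma exists_harmonic_of_mem_span {K F : Set (Euc N)} (hKF : K ⊆ F)
    [CompactSpace K] {s : Fin N → C(K, ℝ)} (hs : s ∈ Submodule.span ℝ (kernelC K '' Fᶜ)) :
    ∃ (O : Set (Euc N)) (h : Euc N → ℝ), IsOpen O ∧ F ⊆ O ∧ ContDiffOn ℝ 2 h O ∧
      (∀ x ∈ O, Laplacian.laplacian h x = 0) ∧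
      ∀ (x : K) (i : Fin N), fderiv ℝ h x (stdVec i) = s i x := by
  induction hs using Submodule.span_induction with
  | mem s hs =>
    obtain ⟨y, hy, rfl⟩ := hs
    have hsub : ∀ x ∈ ({y}ᶜ : Set (Euc N)), -y + x ≠ 0 := fun x hx h =>
      hx (by rw [neg_add_eq_sub, sub_eq_zero] at h; exact h)
    refine ⟨{y}ᶜ, fun x => poleFun N (-y + x), isOpen_compl_singleton,
      fun x hx hxy => hy (hxy ▸ hx),
      contDiffOn_poleFun.comp (contDiff_const.add contDiff_id).contDiffOn hsub,
      fun x hx => ?_, fun x i => ?_⟩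
    · rw [laplacian_comp_add_left, laplacian_poleFun (hsub x hx)]
    · have hyK : y ∉ K := fun h => hy (hKF h)
      have hx : -y + (x : Euc N) ≠ 0 := hsub x fun h => hyK (h ▸ x.2)
      rw [fderiv_comp_add_left, (hasFDerivAt_poleFun hx).fderiv, kernelC_apply hyK]
      simp only [smul_apply, smul_eq_mul, innerSL_apply_apply, EuclideanSpace.inner_single_right]
      rw [neg_add_eq_sub]
      simp
      ring
  | zero => exact ⟨univ, fun _ => 0, isOpen_univ, subset_univ _, contDiffOn_const, by simp,
      by simp⟩
  | add s t _ _ hs ht =>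
    obtain ⟨O, h, hO, hFO, hC, hL, hd⟩ := hs
    obtain ⟨O', h', hO', hFO', hC', hL', hd'⟩ := ht
    refine ⟨O ∩ O', h + h', hO.inter hO', subset_inter hFO hFO',
      (hC.mono inter_subset_left).add (hC'.mono inter_subset_right), fun x hx => ?_, fun x i => ?_⟩
    · rw [ContDiffAt.laplacian_add (hC.contDiffAt (hO.mem_nhds hx.1))
        (hC'.contDiffAt (hO'.mem_nhds hx.2)), hL x hx.1, hL' x hx.2, add_zero]
    · have hx := hKF x.2
      rw [fderiv_add ((hC.contDiffAt (hO.mem_nhds (hFO hx))).differentiableAt (by norm_num))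
        ((hC'.contDiffAt (hO'.mem_nhds (hFO' hx))).differentiableAt (by norm_num))]
      simp [hd, hd']
  | smul c s _ hs =>
    obtain ⟨O, h, hO, hFO, hC, hL, hd⟩ := hs
    refine ⟨O, c • h, hO, hFO, contDiffOn_const.smul hC, fun x hx => ?_, fun x i => ?_⟩
    · rw [InnerProductSpace.laplacian_smul c (hC.contDiffAt (hO.mem_nhds hx)), hL x hx, smul_zero]
    · have hx := hKF x.2
      rw [fderiv_const_smul ((hC.contDiffAt (hO.mem_nhds (hFO hx))).differentiableAt
        (by norm_num))]
      simp [hd]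

end pole

/-! ### Decreasing the supremum of a field -/

/-- Moving `g` against `H` decreases the supremum of `‖g‖` if `⟪g, H⟫ > 0` where it is attained. -/
lemma exists_norm_sub_smul_lt {X V : Type*} [TopologicalSpace X] [NormedAddCommGroup V]
    [InnerProductSpace ℝ V] {C : Set X} (hC : IsCompact C) {g H : X → V} {M : ℝ}
    (hg : ContinuousOn g C) (hH : ContinuousOn H C) (hM : ∀ x ∈ C, ‖g x‖ ≤ M)
    (hpos : ∀ x ∈ C, ‖g x‖ = M → 0 < inner ℝ (g x) (H x)) :
    ∃ t : ℝ, ∀ x ∈ C, ‖g x - t • H x‖ < M := by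
  suffices h : ∃ t₀ > 0, ∀ t : ℝ, 0 < t → t < t₀ → ∀ x ∈ C, ‖g x - t • H x‖ < M by
    obtain ⟨t₀, ht₀, h⟩ := h
    exact ⟨t₀ / 2, h _ (by linarith) (by linarith)⟩
  refine hC.induction_on
    (p := fun s => ∃ t₀ > 0, ∀ t : ℝ, 0 < t → t < t₀ → ∀ x ∈ s, ‖g x - t • H x‖ < M)
    ⟨1, one_pos, by simp⟩ (fun s t hst ⟨t₀, ht₀, h⟩ => ⟨t₀, ht₀, fun τ h0 h1 x hx =>
      h τ h0 h1 x (hst hx)⟩)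
    (fun s t ⟨t₀, ht₀, h⟩ ⟨t₁, ht₁, h'⟩ => ⟨min t₀ t₁, lt_min ht₀ ht₁, fun τ h0 h1 x hx =>
      hx.elim (h τ h0 (h1.trans_le (min_le_left _ _)) x)
        (h' τ h0 (h1.trans_le (min_le_right _ _)) x)⟩) fun x hx => ?_
  have hHx : ∀ᶠ y in 𝓝[C] x, ‖H y‖ < ‖H x‖ + 1 :=
    (hH x hx).norm.eventually_lt_const (lt_add_one _)
  have hB : 0 < ‖H x‖ + 1 := by positivity
  set B := ‖H x‖ + 1
  rcases (hM x hx).lt_or_eq with hlt | heq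
  · obtain ⟨c, hc1, hc2⟩ := exists_between hlt
    refine ⟨_, hHx.and ((hg x hx).norm.eventually_lt_const hc1), (M - c) / B,
      div_pos (by linarith) hB, ?_⟩
    rintro t ht0 ht y ⟨hy1, hy2⟩
    rw [lt_div_iff₀ hB] at ht
    calc _ ≤ ‖g y‖ + ‖t • H y‖ := norm_sub_le _ _
      _ < M := by
        rw [norm_smul, Real.norm_of_nonneg ht0.le]
        nlinarith
  · have hp := hpos x hx heq
    obtain ⟨c, hc0, hc⟩ := exists_between hp
    -- For 0 < t < c / B² the term t² ‖H‖² is below t c, while -2 t ⟪g, H⟫ is below -2 t c, so ‖g -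
    -- t H‖² < M².
    refine ⟨_, (hHx.and ((ContinuousWithinAt.inner (𝕜 := ℝ) (hg x hx) (hH x hx)).eventually_const_lt hc)).and
      self_mem_nhdsWithin, c / B ^ 2, by positivity, ?_⟩
    rintro t ht0 ht y ⟨⟨hy1, hy2⟩, hyC⟩
    rw [lt_div_iff₀ (by positivity)] at ht
    have hMy := hM y hyC
    have hM0 : 0 ≤ M := (norm_nonneg _).trans hMy
    refine lt_of_pow_lt_pow_left₀ 2 hM0 ?_
    rw [norm_sub_sq_real, inner_smul_right, norm_smul, Real.norm_of_nonneg ht0.le, mul_pow]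
    have h1 : ‖g y‖ ^ 2 ≤ M ^ 2 := by gcongr
    have h2 : ‖H y‖ ^ 2 ≤ B ^ 2 := by gcongr
    have h3 : t ^ 2 * ‖H y‖ ^ 2 ≤ t * (t * B ^ 2) := by
      rw [← mul_assoc, ← pow_two]; gcongr
    have h4 : t * (t * B ^ 2) < t * c := by gcongr
    have h5 : t * c < t * inner ℝ (g y) (H y) := by gcongr
    have h6 : 0 < t * c := by positivity
    linarith

/-! ### Pole pushing through the boundary and competitors for the extremal function -/

section extremal
variable {N : ℕ} {Ω : Set (Euc N)} {u : Euc N → ℝ}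

/-- Poles can be pushed from `Ω` to the exterior through a boundary point off `K`. -/
lemma ae_kernelC_mem_poleSpan (hΩ : IsSmoothBoundedDomain Ω) {K : Set (Euc N)} [CompactSpace K]
    (hK : K ⊆ frontier Ω) {p : Euc N} (hp : p ∈ frontier Ω) (hpK : p ∉ K) :
    ∀ᵐ y, kernelC K y ∈ poleSpan K (closure Ω) := by
  have hKc : IsCompact K := isCompact_iff_compactSpace.2 inferInstance
  have hnull : ∀ᵐ y, y ∉ frontier Ω := measure_eq_zero_iff_ae_notMem.1 hΩ.volume_frontier
  filter_upwards [hnull] with y hy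
  by_cases hyc : y ∈ closure Ω
  · have hyΩ : y ∈ Ω := by
      by_contra h
      exact hy (by rw [hΩ.isOpen.frontier_eq]; exact ⟨hyc, h⟩)
    obtain ⟨s, hs, hball⟩ := Metric.isOpen_iff.1 hKc.isClosed.isOpen_compl p hpK
    have hD : IsPreconnected (Ω ∪ Metric.ball p s) := by
      obtain ⟨z, hz1, hz2⟩ := mem_closure_iff_nhds.1 (frontier_subset_closure hp) _
        (Metric.ball_mem_nhds p hs)
      exact hΩ.isConnected.isPreconnected.union z hz2 hz1 (convex_ball p s).isPreconnected
    refine kernelC_mem_poleSpan_of_preconnected isClosed_closure hD ?_ ?_ (Or.inl hyΩ)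
    · refine disjoint_left.2 ?_
      rintro z (hz | hz) hzK
      · have h1 := hK hzK
        rw [hΩ.isOpen.frontier_eq] at h1
        exact h1.2 hz
      · exact hball hz hzK
    -- The starting pole for the continuation is p - t v, which is outside the closure and, for
    -- small t, inside the ball at p.
    · obtain ⟨v, r, hr, hv⟩ := hΩ.exists_transversal hp
      have hpΩ : p ∉ Ω := by
        rw [hΩ.isOpen.frontier_eq] at hp
        exact hp.2
      have hlim : Tendsto (fun t : ℝ => p - t • v) (𝓝[>] 0) (𝓝 p) := by
        have : Continuous fun t : ℝ => p - t • v := by fun_prop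
        simpa using (this.tendsto 0).mono_left nhdsWithin_le_nhds
      have hlt : ∀ᶠ t : ℝ in 𝓝[>] 0, t < r :=
        (eventually_lt_nhds hr).filter_mono nhdsWithin_le_nhds
      obtain ⟨t, ht0, htr, hts⟩ := ((eventually_mem_nhdsWithin (a := (0 : ℝ)) (s := Ioi 0)).and
        (hlt.and (hlim.eventually (Metric.ball_mem_nhds p hs)))).exists
      exact ⟨p - t • v, Or.inr hts, (hv p (Metric.mem_ball_self hr) t ht0 htr).2 hpΩ⟩
  · exact kernelC_mem_poleSpan hyc

lemma gradient_sub_smul {h : Euc N → ℝ} {x : Euc N} (hu : DifferentiableAt ℝ u x)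
    (hh : DifferentiableAt ℝ h x) (t : ℝ) :
    ∇ (fun y => u y - t * h y) x = ∇ u x - t • ∇ h x := by
  have h1 : fderiv ℝ (fun y => u y - t * h y) x = fderiv ℝ u x - t • fderiv ℝ h x :=
    (hu.hasFDerivAt.sub (hh.hasFDerivAt.const_mul t)).fderiv
  simp [gradient, h1]

lemma continuousOn_gradient {h : Euc N → ℝ} {O : Set (Euc N)} (hO : IsOpen O)
    (hh : ContDiffOn ℝ 2 h O) : ContinuousOn (fun x => ∇ h x) O :=
  (InnerProductSpace.toDual ℝ (Euc N)).symm.continuous.comp_continuousOn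
    (hh.continuousOn_fderiv_of_isOpen hO (by norm_num))

lemma IsC1Closure.tendsto_gradClosure (hu : IsC1Closure Ω u) (hΩ : IsOpen Ω) {x : Euc N}
    (hx : x ∈ closure Ω) : Tendsto (fun z => ∇ u z) (𝓝[Ω] x) (𝓝 (gradClosure Ω u x)) := by
  have h1 := ((hu.continuousOn_gradClosure hΩ) x hx).mono_left (nhdsWithin_mono x subset_closure)
  refine h1.congr' ?_
  filter_upwards [self_mem_nhdsWithin] with z hz using hu.gradClosure_eq hΩ hz

/-- Subtracting a function which is harmonic near the closure of `Ω`. -/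
lemma IsC1Closure.sub_smul (hΩ : IsOpen Ω) (hu : IsC1Closure Ω u) {O : Set (Euc N)}
    {h : Euc N → ℝ} (hO : IsOpen O) (hΩO : closure Ω ⊆ O) (hh : ContDiffOn ℝ 2 h O) (t : ℝ) :
    IsC1Closure Ω (fun y => u y - t * h y) ∧
      ∀ x ∈ closure Ω, gradClosure Ω (fun y => u y - t * h y) x =
        gradClosure Ω u x - t • ∇ h x := by
  have hlim : ∀ x ∈ closure Ω, Tendsto (fun z => ∇ (fun y => u y - t * h y) z) (𝓝[Ω] x)
      (𝓝 (gradClosure Ω u x - t • ∇ h x)) := by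
    intro x hx
    have h2 : Tendsto (fun z => ∇ h z) (𝓝[Ω] x) (𝓝 (∇ h x)) :=
      ((continuousOn_gradient hO hh).continuousAt (hO.mem_nhds (hΩO hx))).tendsto.mono_left
        nhdsWithin_le_nhds
    refine ((hu.tendsto_gradClosure hΩ hx).sub (h2.const_smul t)).congr' ?_
    filter_upwards [self_mem_nhdsWithin] with z hz
    exact (gradient_sub_smul ((hu.contDiffOn.contDiffAt (hΩ.mem_nhds hz)).differentiableAt
      (by norm_num)) ((hh.contDiffAt (hO.mem_nhds (hΩO (subset_closure hz)))).differentiableAt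
      (by norm_num)) t).symm
  refine ⟨⟨hu.continuousOn.sub (continuousOn_const.mul (hh.continuousOn.mono hΩO)),
    hu.contDiffOn.sub (contDiffOn_const.mul ((hh.mono (subset_closure.trans hΩO)).of_le
      (by norm_num))), fun x hx => ⟨_, hlim x (frontier_subset_closure hx)⟩⟩,
    fun x hx => extendFrom_eq hx (hlim x hx)⟩

lemma HasLaplacianOn.sub_smul (hΩ : IsOpen Ω) {c : ℝ} (hu : HasLaplacianOn Ω u c)
    {h : Euc N → ℝ} (hh : ContDiffOn ℝ 2 h Ω) (hL : ∀ x ∈ Ω, Laplacian.laplacian h x = 0)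
    (t : ℝ) : HasLaplacianOn Ω (fun y => u y - t * h y) c := by
  refine ⟨hu.1.sub (contDiffOn_const.mul hh), fun x hx => ?_⟩
  have h1 := hu.1.contDiffAt (hΩ.mem_nhds hx)
  have h2 := hh.contDiffAt (hΩ.mem_nhds hx)
  have h3 : (fun y => u y - t * h y) = u - t • h := rfl
  have h4 : ContDiffAt ℝ 2 (t • h) x := h2.const_smul t
  rw [h3, h1.laplacian_sub h4,
    InnerProductSpace.laplacian_smul t h2, hL x hx, hu.2 x hx]
  simp

lemma norm_le_supNormOn {C : Set (Euc N)} (hC : IsCompact C) {g : Euc N → Euc N}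
    (hg : ContinuousOn g C) {x : Euc N} (hx : x ∈ C) : ‖g x‖ ≤ supNormOn C g :=
  le_csSup (hC.image_of_continuousOn hg.norm).bddAbove ⟨x, hx, rfl⟩

lemma supNormOn_lt {C : Set (Euc N)} (hC : IsCompact C) (hne : C.Nonempty) {g : Euc N → Euc N}
    (hg : ContinuousOn g C) {M : ℝ} (hM : ∀ x ∈ C, ‖g x‖ < M) : supNormOn C g < M := by
  obtain ⟨x, hx, h⟩ := (hC.image_of_continuousOn hg.norm).sSup_mem (hne.image _)
  rw [supNormOn, ← h]
  exact hM x hx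

lemma lambdaOne_le {v : Euc N → ℝ} (hv : IsC1Closure Ω v) (hL : HasLaplacianOn Ω v N) :
    lambdaOne Ω ≤ supNormOn (closure Ω) (gradClosure Ω v) := by
  refine csInf_le ⟨0, ?_⟩ ⟨v, hv, hL, rfl⟩
  rintro _ ⟨w, -, -, rfl⟩
  refine Real.sSup_nonneg ?_
  rintro _ ⟨x, -, rfl⟩
  exact norm_nonneg _

/-- If the supremum of the gradient is not attained on the whole boundary, there is a function,
harmonic near the closure, whose gradient makes acute angles with the gradient of `u` wherever the
supremum is attained. -/
lemma exists_harmonic_inner_pos (hN : 2 ≤ N) (hΩ : IsSmoothBoundedDomain Ω)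
    (hu : IsC1Closure Ω u) (hu2 : ContDiffOn ℝ 2 u Ω) {M : ℝ}
    (hint : ∀ x ∈ Ω, gradClosure Ω u x ∈ Metric.ball 0 M)
    {p : Euc N} (hp : p ∈ frontier Ω) (hpM : ‖gradClosure Ω u p‖ < M) :
    ∃ (O : Set (Euc N)) (h : Euc N → ℝ), IsOpen O ∧ closure Ω ⊆ O ∧ ContDiffOn ℝ 2 h O ∧
      (∀ x ∈ O, Laplacian.laplacian h x = 0) ∧
      ∀ x ∈ closure Ω, ‖gradClosure Ω u x‖ = M → 0 < inner ℝ (gradClosure Ω u x) (∇ h x) := by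
  have hM : 0 < M := (norm_nonneg _).trans_lt hpM
  have hN0 : (0 : ℝ) < N := by
    have : 0 < N := by omega
    exact_mod_cast this
  have hgc := hu.continuousOn_gradClosure hΩ.isOpen
  have hcc : IsCompact (closure Ω) := hΩ.isBounded.isCompact_closure
  set K : Set (Euc N) := closure Ω ∩ (fun x => ‖gradClosure Ω u x‖) ⁻¹' {M} with hKdef
  have hKc : IsCompact K := hcc.of_isClosed_subset
    (hgc.norm.preimage_isClosed_of_isClosed isClosed_closure isClosed_singleton) inter_subset_left
  have : CompactSpace K := isCompact_iff_compactSpace.1 hKc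
  have hKf : K ⊆ frontier Ω := by
    intro x hx
    rw [hΩ.isOpen.frontier_eq]
    refine ⟨hx.1, fun hxΩ => ?_⟩
    have h1 := mem_ball_zero_iff.1 (hint x hxΩ)
    have h2 : ‖gradClosure Ω u x‖ = M := hx.2
    exact h1.ne h2
  have hpK : p ∉ K := fun h => hpM.ne h.2
  have hK0 : volume K = 0 := measure_mono_null hKf hΩ.volume_frontier
  obtain ⟨s, hs, hsg⟩ := isPoleLimit_gradClosure hΩ hu hu2 hKf fun φ hφ hφc =>
    isPoleLimit_fderiv hN hK0 (ae_kernelC_mem_poleSpan hΩ hKf hp hpK) hφ hφc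
  -- The tolerance M / (2 N) in each coordinate gives ⟪g, g - ∇h⟫ ≤ N · M · M / (2 N) = M² / 2 on K,
  -- hence ⟪g, ∇h⟫ ≥ M² / 2 > 0.
  obtain ⟨s', hs', hdist⟩ := Metric.mem_closure_iff.1 hs (M / (2 * N)) (by positivity)
  obtain ⟨O, h, hO, hΩO, hC, hL, hd⟩ :=
    exists_harmonic_of_mem_span inter_subset_left hs'
  refine ⟨O, h, hO, hΩO, hC, hL, fun x hx hxM => ?_⟩
  have hxK : x ∈ K := ⟨hx, hxM⟩
  set g := gradClosure Ω u x
  have h1 : ∀ i, |g i - (∇ h x) i| ≤ M / (2 * N) := by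
    intro i
    have h2 : dist (s i ⟨x, hxK⟩) (s' i ⟨x, hxK⟩) ≤ dist s s' :=
      (ContinuousMap.dist_apply_le_dist _).trans (dist_le_pi_dist s s' i)
    rw [hsg i ⟨x, hxK⟩, ← hd ⟨x, hxK⟩ i, ← gradient_apply_eq, Real.dist_eq] at h2
    exact h2.trans hdist.le
  have h3 : inner ℝ g (g - ∇ h x) ≤ M ^ 2 / 2 := by
    calc inner ℝ g (g - ∇ h x) = ∑ i, g i * (g i - (∇ h x) i) := by
          simp [PiLp.inner_apply, mul_comm]
      _ ≤ ∑ _i : Fin N, M * (M / (2 * N)) := by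
          refine Finset.sum_le_sum fun i _ => (le_abs_self _).trans ?_
          rw [abs_mul]
          exact mul_le_mul ((abs_coord_le_norm g i).trans hxM.le) (h1 i) (abs_nonneg _) hM.le
      _ = M ^ 2 / 2 := by
          simp
          field_simp
  rw [inner_sub_right, real_inner_self_eq_norm_sq, hxM] at h3
  nlinarith [pow_pos hM 2]

end extremal

theorem mainTheorem5 (N : ℕ) (hN : 2 ≤ N) (Ω : Set (EuclideanSpace ℝ (Fin N)))
    (hΩ : IsSmoothBoundedDomain Ω) (u : EuclideanSpace ℝ (Fin N) → ℝ)
    (hu : IsC1Closure Ω u) (hΔ : HasLaplacianOn Ω u N)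
    (hmin : supNormOn (closure Ω) (gradClosure Ω u) = lambdaOne Ω) :
    ∀ x ∈ frontier Ω, ‖gradClosure Ω u x‖ = lambdaOne Ω := by
  intro p hp
  have hcc : IsCompact (closure Ω) := hΩ.isBounded.isCompact_closure
  have hgc := hu.continuousOn_gradClosure hΩ.isOpen
  have hle : ∀ x ∈ closure Ω, ‖gradClosure Ω u x‖ ≤ lambdaOne Ω := fun x hx =>
    hmin ▸ norm_le_supNormOn hcc hgc hx
  by_contra hne
  have hpM : ‖gradClosure Ω u p‖ < lambdaOne Ω :=
    lt_of_le_of_ne (hle p (frontier_subset_closure hp)) hne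
  have hint : ∀ x ∈ Ω, gradClosure Ω u x ∈ Metric.ball 0 (lambdaOne Ω) := by
    intro x hx
    rw [mem_ball_zero_iff, hu.gradClosure_eq hΩ.isOpen hx]
    refine norm_gradient_lt_of_laplacian_eq hN hΩ.isOpen hΔ.1 (c := N)
      (by have : N ≠ 0 := by omega
          exact_mod_cast this) hΔ.2 (fun y hy => ?_) hx
    rw [← hu.gradClosure_eq hΩ.isOpen hy]
    exact hle y (subset_closure hy)
  obtain ⟨O, h, hO, hΩO, hC, hL, hpos⟩ :=
    exists_harmonic_inner_pos hN hΩ hu hΔ.1 hint hp hpM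
  -- The competitor u - t h has the same Laplacian, and by compactness its gradient has supremum
  -- strictly below the infimum.
  obtain ⟨t, ht⟩ := exists_norm_sub_smul_lt hcc hgc ((continuousOn_gradient hO hC).mono hΩO) hle
    hpos
  obtain ⟨hv, hvg⟩ := hu.sub_smul hΩ.isOpen hO hΩO hC t
  have hvL := hΔ.sub_smul hΩ.isOpen (hC.mono (subset_closure.trans hΩO))
    (fun x hx => hL x (hΩO (subset_closure hx))) t
  have h1 := supNormOn_lt hcc hΩ.isConnected.nonempty.closure
    (hv.continuousOn_gradClosure hΩ.isOpen) (M := lambdaOne Ω) fun x hx => by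
      rw [hvg x hx]; exact ht x hx
  exact absurd (lambdaOne_le hv hvL) (not_le.2 h1)
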